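/- Let $\mathbb{F}$ be an algebraically closed field of characteristic $p>0$. A restricted Lie algebra over $\mathbb{F}$ is a Lie algebra $L$ over $\mathbb{F}$ together with a map $x\mapsto x^{[p]}$ from $L$ to $L$ such that, for all $x,y\in L$ and $\alpha\in\mathbb{F}$, $(\alpha x)^{[p]}=\alpha^p x^{[p]}$, $\operatorname{ad}(x^{[p]})=(\operatorname{ad} x)^p$, and $(x+y)^{[p]}=x^{[p]}+y^{[p]}+\sum_{i=1}^{p-1}s_i(x,y)$, where $i\,s_i(x,y)$ is the coefficient of $t^{i-1}$ in $(\operatorname{ad}(tx+y))^{p-1}(x)$. Its restricted enveloping algebra $u(L)$ is the quotient of the universal enveloping algebra $U(L)$ by the two-sided ideal generated by all elements $x^p-x^{[p]}$ with $x\in L$. Let $L$ be a finite-dimensional abelian restricted Lie algebra over $\mathbb{F}$, and let $H$ be any restricted Lie algebra over $\mathbb{F}$ such that $u(L)\cong u(H)$ as associative $\mathbb{F}$-algebras. Then $L\cong H$ as restricted Lie algebras, that is, there is an isomorphism of Lie algebras $L\to H$ that commutes with the maps $x\mapsto x^{[p]}$. -/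

import Mathlib

/-- The Jacobson element `sᵢ(x, y)` of a Lie algebra over a field: `i • sᵢ(x, y)` is the coefficient
of `tⁱ⁻¹` in `(ad (t x + y))ᵖ⁻¹ (x)`, for `1 ≤ i ≤ p - 1`. The polynomial in `t` is taken with
coefficients in `End_F(L)`, the variable being central. -/
noncomputable def jacobsonElement (p : ℕ) (F : Type*) {L : Type*} [Field F] [LieRing L]
    [LieAlgebra F L] (i : ℕ) (x y : L) : L :=
  (i : F)⁻¹ •
    ((Polynomial.X * Polynomial.C (LieAlgebra.ad F L x : Module.End F L)
        + Polynomial.C (LieAlgebra.ad F L y : Module.End F L)) ^ (p - 1)).coeff (i - 1) x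

/-- A restricted Lie algebra over a field `F` of characteristic `p`: a Lie algebra `L` with a
`p`-map `x ↦ x^[p]` satisfying Jacobson's three axioms. -/
class RestrictedLieAlgebra (p : ℕ) (F : Type*) (L : Type*) [Field F] [LieRing L]
    [LieAlgebra F L] where
  /-- The `p`-map. -/
  pMap : L → L
  pMap_smul : ∀ (a : F) (x : L), pMap (a • x) = a ^ p • pMap x
  ad_pMap : ∀ x : L,
    (LieAlgebra.ad F L (pMap x) : Module.End F L) = (LieAlgebra.ad F L x : Module.End F L) ^ p
  pMap_add : ∀ x y : L,
    pMap (x + y) = pMap x + pMap y + ∑ i ∈ Finset.Icc 1 (p - 1), jacobsonElement p F i x y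

/-- The relations `x ^ p = x^[p]`, for `x` in `L`, in the universal enveloping algebra of `L`. -/
inductive RestrictedEnvelopingAlgebra.Rel (p : ℕ) (F : Type*) (L : Type*) [Field F] [LieRing L]
    [LieAlgebra F L] [RestrictedLieAlgebra p F L] :
    UniversalEnvelopingAlgebra F L → UniversalEnvelopingAlgebra F L → Prop
  | pow_p (x : L) : Rel p F L (UniversalEnvelopingAlgebra.ι F x ^ p)
      (UniversalEnvelopingAlgebra.ι F (RestrictedLieAlgebra.pMap p F x))

/-- The restricted enveloping algebra `u(L)`: the quotient of the universal enveloping algebra by the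
two-sided ideal generated by the elements `x ^ p - x^[p]`, `x` in `L`. -/
abbrev RestrictedEnvelopingAlgebra (p : ℕ) (F : Type*) (L : Type*) [Field F] [LieRing L]
    [LieAlgebra F L] [RestrictedLieAlgebra p F L] : Type _ :=
  RingQuot (RestrictedEnvelopingAlgebra.Rel p F L)

/-- An isomorphism of restricted Lie algebras: an isomorphism of Lie algebras that commutes with the
`p`-maps. -/
structure RestrictedLieEquiv (p : ℕ) (F : Type*) (L H : Type*) [Field F]
    [LieRing L] [LieAlgebra F L] [RestrictedLieAlgebra p F L]
    [LieRing H] [LieAlgebra F H] [RestrictedLieAlgebra p F H] extends L ≃ₗ⁅F⁆ H where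
  map_pMap : ∀ x : L, toLieEquiv (RestrictedLieAlgebra.pMap p F x) =
    RestrictedLieAlgebra.pMap p F (toLieEquiv x)

/-! The algebra sees the p-map through its p-th powers. If L is abelian with p-map φ, then φ is
Frobenius-semilinear and u(L) is the commutative algebra generated by L with relations v^p = φ(v);
the monomials in a basis of L with exponents below p form a basis of it. Taking p^k-th powers
replaces v by φ^k(v), so the p^k-th powers span a space of dimension p^(dim φ^k(L))
(`finrank_powSpan`), and the algebra determines the ranks of all iterates of φ. Over an
algebraically closed field these ranks classify φ
(`exists_linearEquiv_of_finrank_iteratedRange_eq`): an injective φ has a basis of fixed vectors, and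
otherwise an isomorphism between the images of two such maps extends to the whole spaces.

It remains to see that H is abelian when u(H) is commutative (`isLieAbelian_of_mul_comm`), which is
done without the Poincaré–Birkhoff–Witt theorem. The adjoint representation factors through u(H), so
commutators in H are central. Write the bracket as β(x, y) - β(y, x), with β bilinear,
central-valued and zero when an argument is central, and let S be the commutative algebra generated
by H with relations v^p = v^[p] - β(v, v). Multiplication by v plus the derivation extending β(v, ·)
defines an action of u(H) on S in which a central z acts as multiplication by z. Commutators act as
zero and H embeds in S, so they vanish. -/

/-! ### Injective Frobenius-semilinear maps: bases of fixed vectors -/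

section Semilinear

open Polynomial in
/-- Over an algebraically closed field of characteristic `p`, the recursion expressing that
`∑ cᵢ φⁱ(v)` is fixed by the Frobenius-semilinear map `φ` has a solution with `cₘ ≠ 0`. -/
theorem exists_frobenius_recursion {p : ℕ} [Fact p.Prime] {F : Type*} [Field F] [IsAlgClosed F]
    (m : ℕ) (a : ℕ → F) (ha : a 0 ≠ 0) :
    ∃ c : ℕ → F, c m ≠ 0 ∧ c 0 = a 0 * c m ^ p ∧
      ∀ i, c (i + 1) = c i ^ p + a (i + 1) * c m ^ p := by
  have hp : 2 ≤ p := (Fact.out : p.Prime).two_le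
  -- With t in place of `c m`, the recursion makes each `c i` a polynomial `q i` in t. The only
  -- condition left is that t be a nonzero solution of `q m` = t.
  let q : ℕ → F[X] := fun n =>
    Nat.rec (C (a 0) * X ^ p) (fun i q => q ^ p + C (a (i + 1)) * X ^ p) n
  have hq0 : q 0 = C (a 0) * X ^ p := rfl
  have hq1 : ∀ i, q (i + 1) = q i ^ p + C (a (i + 1)) * X ^ p := fun _ => rfl
  have hdeg : ∀ i, (q i).natDegree = p ^ (i + 1) := by
    intro i
    induction i with
    | zero => rw [hq0, natDegree_C_mul_X_pow _ _ ha]; simp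
    | succ i ih =>
      have h1 : (q i ^ p).natDegree = p ^ (i + 2) := by rw [natDegree_pow, ih]; ring
      rw [hq1, natDegree_add_eq_left_of_natDegree_lt, h1]
      rw [h1]
      refine (natDegree_C_mul_X_pow_le _ _).trans_lt ?_
      calc p = p ^ 1 := (pow_one p).symm
        _ < p ^ (i + 2) := Nat.pow_lt_pow_right (by omega) (by omega)
  have hdvd : ∀ i, X ^ p ∣ q i := by
    intro i
    induction i with
    | zero => exact Dvd.intro_left _ rfl
    | succ i ih =>
      rw [hq1]
      exact dvd_add (ih.trans (dvd_pow_self _ (by omega))) (Dvd.intro_left _ rfl)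
  -- Dividing `q m` = t by t leaves t^(p-1) g(t) = 1, whose roots are automatically nonzero.
  obtain ⟨g, hg⟩ := hdvd m
  have hg0 : g ≠ 0 := by
    rintro rfl
    have h := hdeg m
    rw [hg, mul_zero, natDegree_zero] at h
    exact (pow_ne_zero (m + 1) (by omega : p ≠ 0)) h.symm
  have hne : (X ^ (p - 1) * g - 1).degree ≠ 0 := by
    have h1 : (X ^ (p - 1) * g).natDegree = p - 1 + g.natDegree := by
      rw [natDegree_mul (pow_ne_zero _ X_ne_zero) hg0, natDegree_X_pow]
    have h2 : (X ^ (p - 1) * g - 1).natDegree = p - 1 + g.natDegree := by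
      rw [← C_1, natDegree_sub_C, h1]
    intro h
    have := natDegree_eq_of_degree_eq_some (n := 0) h
    omega
  obtain ⟨t, ht⟩ := IsAlgClosed.exists_root _ hne
  have ht1 : t ^ (p - 1) * g.eval t = 1 := by
    have : t ^ (p - 1) * g.eval t - 1 = 0 := by simpa [IsRoot.def] using ht
    exact sub_eq_zero.mp this
  have hqm : (q m).eval t = t := by
    rw [hg, eval_mul, eval_pow, eval_X]
    calc t ^ p * g.eval t = t * (t ^ (p - 1) * g.eval t) := by
          rw [← mul_assoc, ← pow_succ', Nat.sub_add_cancel (by omega)]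
      _ = t := by rw [ht1, mul_one]
  refine ⟨fun i => (q i).eval t, ?_, ?_, ?_⟩
  · simp only [hqm]
    rintro rfl
    rw [zero_pow (by omega), zero_mul] at ht1
    exact zero_ne_one ht1
  · simp only [hqm]
    simp [hq0]
  · intro i
    simp only [hqm]
    simp [hq1]

-- Artin–Schreier equations, used to solve φ(s) - s = t on the span of the fixed vectors.
open Polynomial in
theorem exists_pow_sub_self_eq {p : ℕ} [Fact p.Prime] {F : Type*} [Field F] [IsAlgClosed F]
    (a : F) : ∃ c : F, c ^ p - c = a := by
  have hp : 1 < p := (Fact.out : p.Prime).one_lt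
  have hdeg : (X ^ p - X - C a : F[X]).natDegree = p := by
    rw [natDegree_sub_C]
    exact (natDegree_sub_eq_left_of_natDegree_lt (by simpa using hp)).trans (natDegree_X_pow p)
  obtain ⟨c, hc⟩ := IsAlgClosed.exists_root (X ^ p - X - C a : F[X]) fun h => by
    have := natDegree_eq_of_degree_eq_some (n := 0) h
    omega
  exact ⟨c, by simpa [sub_eq_zero] using hc⟩

/-- Over a perfect field the image of a subspace under a Frobenius-semilinear map is again a
subspace; this instance makes `Submodule.map` and `LinearMap.range` available for such maps. -/
instance frobenius_ringHomSurjective {p : ℕ} {F : Type*} [CommSemiring F] [ExpChar F p]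
    [PerfectRing F p] : RingHomSurjective (frobenius F p) :=
  ⟨surjective_frobenius F p⟩

variable {p : ℕ} [Fact p.Prime] {F : Type*} [Field F] [CharP F p]
  {V : Type*} [AddCommGroup V] [Module F V]

/-- An injective Frobenius-semilinear endomorphism of a nonzero finite-dimensional space over an
algebraically closed field has a nonzero fixed vector. -/
theorem exists_ne_zero_fixed_of_injective [IsAlgClosed F] [FiniteDimensional F V] [Nontrivial V]
    (φ : V →ₛₗ[frobenius F p] V) (hφ : Function.Injective φ) : ∃ w : V, w ≠ 0 ∧ φ w = w := by
  classical
  obtain ⟨v, hv⟩ := exists_ne (0 : V)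
  let N : ℕ → Submodule F V := fun m =>
    Submodule.span F ((fun i => φ^[i] v) '' (Finset.range m : Set ℕ))
  have hN : ∀ m x, x ∈ N m ↔ ∃ a : ℕ → F, ∑ i ∈ Finset.range m, a i • φ^[i] v = x := by
    intro m x
    rw [Submodule.mem_span_image_finset_iff_exists_fun F]
    constructor
    · rintro ⟨c, rfl⟩
      refine ⟨fun i => if h : i ∈ Finset.range m then c ⟨i, h⟩ else 0, ?_⟩
      rw [← Finset.sum_coe_sort]
      exact Finset.sum_congr rfl fun i _ => by simp only [dif_pos i.2]
    · rintro ⟨a, rfl⟩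
      exact ⟨fun i => a i, Finset.sum_coe_sort (Finset.range m) fun i => a i • φ^[i] v⟩
  have hmono : Monotone N := fun a b hab => Submodule.span_mono (Set.image_mono (by simpa using hab))
  have hex : ∃ m, φ^[m] v ∈ N m := by
    obtain ⟨n, hn⟩ := monotone_stabilizes_iff_noetherian.mpr
      (inferInstance : IsNoetherian F V) ⟨N, hmono⟩
    refine ⟨n, ?_⟩
    have h1 : N n = N (n + 1) := hn (n + 1) (Nat.le_succ n)
    rw [h1]
    exact Submodule.subset_span ⟨n, by simp, rfl⟩
  obtain ⟨m, hm, hmin⟩ : ∃ m, φ^[m] v ∈ N m ∧ ∀ k < m, φ^[k] v ∉ N k :=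
    ⟨Nat.find hex, Nat.find_spec hex, fun k hk => Nat.find_min hex hk⟩
  cases m with
  | zero => exact absurd (by simpa [N] using hm) hv
  | succ m =>
    obtain ⟨a, ha⟩ := (hN _ _).mp hm
    -- If `a 0` vanished, taking p-th roots of the other coefficients and cancelling φ would give a
    -- shorter relation, against minimality.
    have ha0 : a 0 ≠ 0 := by
      intro h0
      choose b hb using fun i => surjective_frobenius F p (a i)
      apply hmin m (Nat.lt_succ_self m)
      rw [hN]
      refine ⟨fun i => b (i + 1), hφ ?_⟩
      rw [Finset.sum_range_succ', h0, zero_smul, add_zero] at ha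
      rw [← Function.iterate_succ_apply' φ m v, ← ha, map_sum]
      refine Finset.sum_congr rfl fun i _ => ?_
      rw [map_smulₛₗ, hb, Function.iterate_succ_apply']
    -- Comparing coefficients in φ(w) = w for w = ∑ cᵢ φⁱ(v), with φ^(m+1)(v) rewritten by the
    -- relation `ha`, gives exactly this recursion.
    obtain ⟨c, hc, hc0, hc1⟩ := exists_frobenius_recursion (p := p) m a ha0
    refine ⟨∑ i ∈ Finset.range (m + 1), c i • φ^[i] v, ?_, ?_⟩
    · intro hw
      apply hmin m (Nat.lt_succ_self m)
      rw [Finset.sum_range_succ] at hw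
      have h1 : φ^[m] v = (c m)⁻¹ • (-∑ i ∈ Finset.range m, c i • φ^[i] v) := by
        rw [← eq_neg_of_add_eq_zero_right hw, smul_smul, inv_mul_cancel₀ hc, one_smul]
      rw [h1]
      exact Submodule.smul_mem _ _ (Submodule.neg_mem _ ((hN _ _).mpr ⟨c, rfl⟩))
    · rw [map_sum, Finset.sum_range_succ]
      simp only [map_smulₛₗ, frobenius_def, ← Function.iterate_succ_apply' φ]
      rw [← ha, Finset.smul_sum, Finset.sum_range_succ', Finset.sum_range_succ' (fun i => c i • _),
        ← add_assoc, ← Finset.sum_add_distrib, hc0]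
      congr 1
      · refine Finset.sum_congr rfl fun i _ => ?_
        rw [smul_smul, ← add_smul, hc1, mul_comm (c m ^ p)]
      · rw [smul_smul, mul_comm]

/-- The fixed vectors of an injective Frobenius-semilinear endomorphism of a finite-dimensional
space over an algebraically closed field span the space. -/
theorem span_fixed_eq_top_of_injective [IsAlgClosed F] [FiniteDimensional F V]
    (φ : V →ₛₗ[frobenius F p] V) (hφ : Function.Injective φ) :
    Submodule.span F {v : V | φ v = v} = ⊤ := by
  set T := Submodule.span F {v : V | φ v = v} with hT
  have hle : T ≤ T.comap φ := Submodule.span_le.mpr fun v hv => by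
    have hv' : φ v = v := hv
    simpa [hv'] using Submodule.subset_span (s := {v : V | φ v = v}) hv
  have hle' : T ≤ T.map φ := Submodule.span_le.mpr fun v hv =>
    ⟨v, Submodule.subset_span hv, hv⟩
  have hsol : ∀ t ∈ T, ∃ s ∈ T, φ s - s = t := by
    intro t ht
    induction ht using Submodule.closure_induction with
    | zero => exact ⟨0, T.zero_mem, by simp⟩
    | add x y _ _ hx hy =>
      obtain ⟨s, hs, rfl⟩ := hx
      obtain ⟨s', hs', rfl⟩ := hy
      exact ⟨s + s', T.add_mem hs hs', by rw [map_add]; abel⟩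
    | smul_mem a x hx =>
      obtain ⟨c, hc⟩ := exists_pow_sub_self_eq (p := p) a
      refine ⟨c • x, T.smul_mem _ (Submodule.subset_span hx), ?_⟩
      have hx' : φ x = x := hx
      rw [map_smulₛₗ, hx', frobenius_def, ← sub_smul, hc]
  by_contra hne
  have : Nontrivial (V ⧸ T) := Submodule.Quotient.nontrivial_iff.mpr hne
  have hinj : Function.Injective (T.mapQ T φ hle) := by
    rw [injective_iff_map_eq_zero]
    intro x hx
    obtain ⟨x, rfl⟩ := T.mkQ_surjective x
    have hx' : φ x ∈ T := (Submodule.Quotient.mk_eq_zero T).mp hx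
    obtain ⟨y, hy, hyx⟩ := hle' hx'
    rw [← hφ hyx]
    exact (Submodule.Quotient.mk_eq_zero T).mpr hy
  -- A fixed vector of the quotient lifts to a genuine one: φ(w) - w lies in T, hence equals φ(s) -
  -- s with s in T, and w - s is fixed. So w was already in T.
  obtain ⟨w, hw0, hw⟩ := exists_ne_zero_fixed_of_injective (T.mapQ T φ hle) hinj
  obtain ⟨w, rfl⟩ := T.mkQ_surjective w
  have hw' : φ w - w ∈ T := (Submodule.Quotient.eq T).mp hw
  obtain ⟨s, hs, hs'⟩ := hsol _ hw'
  apply hw0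
  refine (Submodule.Quotient.mk_eq_zero T).mpr ?_
  have hfix : w - s ∈ T := Submodule.subset_span (by
    change φ (w - s) = w - s
    rw [map_sub, ← sub_eq_zero]
    rw [← sub_eq_zero] at hs'
    rw [← neg_eq_zero, ← hs']
    abel)
  simpa using T.add_mem hfix hs

theorem exists_basis_fixed_of_injective [IsAlgClosed F] [FiniteDimensional F V]
    (φ : V →ₛₗ[frobenius F p] V) (hφ : Function.Injective φ) :
    ∃ b : Module.Basis (Fin (Module.finrank F V)) F V, ∀ i, φ (b i) = b i := by
  have hs := span_fixed_eq_top_of_injective φ hφ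
  have hsub : Set.range (Module.Basis.ofSpan hs.ge) ⊆ {v : V | φ v = v} :=
    Module.Basis.ofSpan_subset hs.ge
  generalize Module.Basis.ofSpan hs.ge = b at hsub
  have := Module.Finite.finite_basis b
  let e := Finite.equivFinOfCardEq (Module.finrank_eq_nat_card_basis b).symm
  refine ⟨b.reindex e, fun i => ?_⟩
  rw [Module.Basis.reindex_apply]
  exact hsub (Set.mem_range_self _)

/-- Two finite-dimensional spaces of the same dimension with injective Frobenius-semilinear
endomorphisms are isomorphic, over an algebraically closed field. -/
theorem exists_linearEquiv_of_injective [IsAlgClosed F] [FiniteDimensional F V]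
    {W : Type*} [AddCommGroup W] [Module F W] [FiniteDimensional F W]
    (φ : V →ₛₗ[frobenius F p] V) (hφ : Function.Injective φ)
    (ψ : W →ₛₗ[frobenius F p] W) (hψ : Function.Injective ψ)
    (h : Module.finrank F V = Module.finrank F W) :
    ∃ g : V ≃ₗ[F] W, ∀ v, g (φ v) = ψ (g v) := by
  obtain ⟨b, hb⟩ := exists_basis_fixed_of_injective φ hφ
  obtain ⟨c, hc⟩ := exists_basis_fixed_of_injective ψ hψ
  let g := b.equiv c (finCongr h)
  refine ⟨g, fun v => ?_⟩
  have : g.toLinearMap.comp φ = ψ.comp g.toLinearMap := by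
    refine b.ext fun i => ?_
    simp [hb, g, hc]
  exact LinearMap.congr_fun this v

end Semilinear

/-! ### Classification of semilinear endomorphisms by the ranks of their iterates -/

section SemilinearClassification

theorem Submodule.exists_inf_eq_bot_sup_eq {F V : Type*} [Field F] [AddCommGroup V] [Module F V]
    {A N : Submodule F V} (h : A ≤ N) : ∃ C ≤ N, A ⊓ C = ⊥ ∧ A ⊔ C = N := by
  obtain ⟨X, hX⟩ := exists_isCompl A
  refine ⟨X ⊓ N, inf_le_right, ?_, ?_⟩
  · rw [← inf_assoc, hX.inf_eq_bot, bot_inf_eq]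
  · rw [← sup_inf_assoc_of_le X h, hX.sup_eq_top, top_inf_eq]

variable {p : ℕ} [Fact p.Prime] {F : Type*} [Field F] [CharP F p] [PerfectRing F p]
  {V : Type*} [AddCommGroup V] [Module F V] {W : Type*} [AddCommGroup W] [Module F W]

/-- Rank–nullity survives semilinearity: a complement of the kernel in N maps bijectively onto φ(N),
and a bijection semilinear along a field automorphism preserves dimension. -/
theorem Submodule.finrank_inf_ker_add_finrank_map_frobenius [FiniteDimensional F V]
    (φ : V →ₛₗ[frobenius F p] W) (N : Submodule F V) :
    Module.finrank F ↥(N ⊓ LinearMap.ker φ) + Module.finrank F ↥(N.map φ) =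
      Module.finrank F N := by
  obtain ⟨C, hCN, hinf, hsup⟩ :=
    Submodule.exists_inf_eq_bot_sup_eq (inf_le_left : N ⊓ LinearMap.ker φ ≤ N)
  have hmap : N.map φ = C.map φ := by
    rw [← hsup, Submodule.map_sup, sup_eq_right]
    rintro _ ⟨x, hx, rfl⟩
    rw [LinearMap.mem_ker.mp hx.2]
    exact zero_mem _
  have hfin : Module.finrank F C = Module.finrank F ↥(C.map φ) := by
    let f : C →+ C.map φ :=
      { toFun := fun x => ⟨φ x, x, x.2, rfl⟩
        map_zero' := by ext; simp
        map_add' := fun x y => by ext; simp }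
    have hf : Function.Bijective f := by
      refine ⟨(injective_iff_map_eq_zero f).mpr fun x hx => ?_, ?_⟩
      · have h0 : φ x = 0 := congrArg Subtype.val hx
        have : (x : V) ∈ (N ⊓ LinearMap.ker φ) ⊓ C := ⟨⟨hCN x.2, h0⟩, x.2⟩
        rw [hinf] at this
        exact Subtype.ext this
      · rintro ⟨_, x, hx, rfl⟩
        exact ⟨⟨x, hx⟩, rfl⟩
    have := lift_rank_eq_of_equiv_equiv (frobenius F p) (AddEquiv.ofBijective f hf)
      (bijective_frobenius F p) fun r m => Subtype.ext (map_smulₛₗ φ r (m : V))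
    simpa [Module.finrank] using congrArg Cardinal.toNat this
  have := Submodule.finrank_sup_add_finrank_inf_eq (N ⊓ LinearMap.ker φ) C
  rw [hsup, hinf, finrank_bot] at this
  rw [hmap, ← hfin]
  omega

/-- The image of the `k`-fold iterate of a semilinear endomorphism. -/
def iteratedRange (φ : V →ₛₗ[frobenius F p] V) : ℕ → Submodule F V
  | 0 => ⊤
  | k + 1 => (iteratedRange φ k).map φ

theorem mem_iteratedRange {φ : V →ₛₗ[frobenius F p] V} {k : ℕ} {x : V} :
    x ∈ iteratedRange φ k ↔ ∃ v, φ^[k] v = x := by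
  induction k generalizing x with
  | zero => simp [iteratedRange]
  | succ k ih =>
    simp only [iteratedRange, Submodule.mem_map, ih, Function.iterate_succ_apply']
    constructor
    · rintro ⟨_, ⟨v, rfl⟩, rfl⟩
      exact ⟨v, rfl⟩
    · rintro ⟨v, rfl⟩
      exact ⟨_, ⟨v, rfl⟩, rfl⟩

/-- A semilinear endomorphism restricted to its range. -/
def rangeRestrictEnd (φ : V →ₛₗ[frobenius F p] V) :
    LinearMap.range φ →ₛₗ[frobenius F p] LinearMap.range φ where
  toFun x := ⟨φ x, x, rfl⟩
  map_add' x y := Subtype.ext (map_add φ (x : V) y)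
  map_smul' a x := Subtype.ext (map_smulₛₗ φ a (x : V))

theorem map_subtype_iteratedRange_rangeRestrictEnd (φ : V →ₛₗ[frobenius F p] V) (k : ℕ) :
    (iteratedRange (rangeRestrictEnd φ) k).map (LinearMap.range φ).subtype =
      iteratedRange φ (k + 1) := by
  induction k with
  | zero =>
    simp only [iteratedRange, Submodule.map_top, Submodule.range_subtype]
  | succ k ih =>
    rw [iteratedRange, iteratedRange, ← ih]
    ext x
    constructor
    · rintro ⟨_, ⟨y, hy, rfl⟩, rfl⟩
      exact ⟨y, ⟨y, hy, rfl⟩, rfl⟩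
    · rintro ⟨_, ⟨y, hy, rfl⟩, rfl⟩
      exact ⟨rangeRestrictEnd φ y, ⟨y, hy, rfl⟩, rfl⟩

theorem finrank_iteratedRange_rangeRestrictEnd (φ : V →ₛₗ[frobenius F p] V) (k : ℕ) :
    Module.finrank F ↥(iteratedRange (rangeRestrictEnd φ) k) =
      Module.finrank F ↥(iteratedRange φ (k + 1)) := by
  rw [← map_subtype_iteratedRange_rangeRestrictEnd]
  exact (Submodule.equivMapOfInjective _ Subtype.val_injective _).finrank_eq

/-- An isomorphism between the ranges of two semilinear endomorphisms, compatible with them,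
extends to an isomorphism of the whole spaces when the relevant dimensions agree. -/
theorem exists_linearEquiv_of_range_equiv [FiniteDimensional F V] [FiniteDimensional F W]
    (φ : V →ₛₗ[frobenius F p] V) (ψ : W →ₛₗ[frobenius F p] W)
    (hVW : Module.finrank F V = Module.finrank F W)
    (hker : Module.finrank F (LinearMap.ker φ) = Module.finrank F (LinearMap.ker ψ))
    (hinf : Module.finrank F ↥(LinearMap.range φ ⊓ LinearMap.ker φ) =
      Module.finrank F ↥(LinearMap.range ψ ⊓ LinearMap.ker ψ))
    (f : LinearMap.range φ ≃ₗ[F] LinearMap.range ψ)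
    (hf : ∀ x, f (rangeRestrictEnd φ x) = rangeRestrictEnd ψ (f x)) :
    ∃ g : V ≃ₗ[F] W, ∀ v, g (φ v) = ψ (g v) := by
  -- The decomposition is V = range φ ⊕ K ⊕ U, with range φ ⊕ K = range φ + ker φ. The extension is
  -- `f` on the range, any isomorphism of K with `K'`, and on U a lift of `f` ∘ φ through ψ.
  obtain ⟨K, hK, hKinf, hKsup⟩ := Submodule.exists_inf_eq_bot_sup_eq
    (inf_le_right : LinearMap.range φ ⊓ LinearMap.ker φ ≤ LinearMap.ker φ)
  obtain ⟨K', hK', hKinf', hKsup'⟩ := Submodule.exists_inf_eq_bot_sup_eq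
    (inf_le_right : LinearMap.range ψ ⊓ LinearMap.ker ψ ≤ LinearMap.ker ψ)
  have hKK' : Module.finrank F K = Module.finrank F K' := by
    have h1 := Submodule.finrank_sup_add_finrank_inf_eq (LinearMap.range φ ⊓ LinearMap.ker φ) K
    have h2 := Submodule.finrank_sup_add_finrank_inf_eq (LinearMap.range ψ ⊓ LinearMap.ker ψ) K'
    rw [hKinf, hKsup, finrank_bot] at h1
    rw [hKinf', hKsup', finrank_bot] at h2
    omega
  let h : K ≃ₗ[F] K' := LinearEquiv.ofFinrankEq _ _ hKK'
  obtain ⟨U, hU⟩ := exists_isCompl (LinearMap.range φ ⊔ LinearMap.ker φ)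
  obtain ⟨g₀, hg₀⟩ : ∃ g₀ : U →ₗ[F] W, ∀ u : U, ψ (g₀ u) = f ⟨φ u, u, rfl⟩ := by
    let b := Module.Basis.ofVectorSpace F U
    choose w hw using fun i => LinearMap.mem_range.mp (f ⟨φ (b i), b i, rfl⟩).2
    let l : U →ₛₗ[frobenius F p] LinearMap.range φ :=
      { toFun := fun u => ⟨φ u, u, rfl⟩
        map_add' := fun x y => Subtype.ext (map_add φ (x : V) y)
        map_smul' := fun a x => Subtype.ext (map_smulₛₗ φ a (x : V)) }
    refine ⟨b.constr F w, fun u => ?_⟩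
    have : ψ.comp (b.constr F w) =
        ((LinearMap.range ψ).subtype.comp f.toLinearMap).comp l := by
      refine b.ext fun i => ?_
      simp only [LinearMap.comp_apply, Module.Basis.constr_basis, hw]
      rfl
    exact LinearMap.congr_fun this u
  -- parametrisations of `V` and of `W` by `range φ × K × U`
  let α : (LinearMap.range φ × K × U) →ₗ[F] V :=
    (LinearMap.range φ).subtype.coprod (K.subtype.coprod U.subtype)
  let γ : (LinearMap.range φ × K × U) →ₗ[F] W :=
    ((LinearMap.range ψ).subtype.comp f.toLinearMap).coprod
      ((K'.subtype.comp h.toLinearMap).coprod g₀)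
  have hφK : ∀ k : K, φ k = 0 := fun k => hK k.2
  have hψK : ∀ k : K', ψ k = 0 := fun k => hK' k.2
  have hαinj : Function.Injective α := by
    rw [injective_iff_map_eq_zero]
    rintro ⟨x, k, u⟩ h0
    have h0' : (x : V) + (k + u) = 0 := h0
    have hu : (u : V) = 0 := by
      have : (u : V) ∈ (LinearMap.range φ ⊔ LinearMap.ker φ) ⊓ U := by
        refine ⟨?_, u.2⟩
        have : (u : V) = -x + -k := by
          rw [← sub_eq_zero, ← h0']; abel
        rw [this]
        exact Submodule.add_mem_sup (neg_mem x.2) (neg_mem (hK k.2))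
      rwa [hU.inf_eq_bot] at this
    rw [hu, add_zero] at h0'
    have hk : (k : V) = 0 := by
      have : (k : V) ∈ (LinearMap.range φ ⊓ LinearMap.ker φ) ⊓ K := by
        refine ⟨⟨?_, hK k.2⟩, k.2⟩
        rw [eq_neg_of_add_eq_zero_right h0']
        exact neg_mem x.2
      rwa [hKinf] at this
    rw [hk, add_zero] at h0'
    rw [show x = 0 from Subtype.ext h0', show k = 0 from Subtype.ext hk,
      show u = 0 from Subtype.ext hu]
    rfl
  have hαsurj : Function.Surjective α := by
    intro v
    have hv : v ∈ (LinearMap.range φ ⊔ LinearMap.ker φ) ⊔ U := by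
      rw [hU.sup_eq_top]; trivial
    obtain ⟨y, hy, u, hu, rfl⟩ := Submodule.mem_sup.mp hv
    obtain ⟨x, hx, z, hz, rfl⟩ := Submodule.mem_sup.mp hy
    rw [← hKsup] at hz
    obtain ⟨x', hx', k, hk, rfl⟩ := Submodule.mem_sup.mp hz
    refine ⟨(⟨x + x', add_mem hx hx'.1⟩, ⟨k, hk⟩, ⟨u, hu⟩), ?_⟩
    change x + x' + (k + u) = x + (x' + k) + u
    abel
  have hγinj : Function.Injective γ := by
    rw [injective_iff_map_eq_zero]
    rintro ⟨x, k, u⟩ h0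
    have h0' : (f x : W) + (h k + g₀ u) = 0 := h0
    -- Applying ψ removes the `K'` part and turns the rest into f(φ(x + u)). Hence x + u is in ker
    -- φ, which puts u in U ∩ (range φ + ker φ) = 0.
    have hxu : φ (x + u) = 0 := by
      have h1 := congrArg ψ h0'
      rw [map_add, map_add, hψK, zero_add, hg₀, map_zero] at h1
      have h2 : f (rangeRestrictEnd φ x + ⟨φ u, u, rfl⟩) = 0 := by
        rw [map_add, hf]
        exact Subtype.ext h1
      rw [map_add]
      exact congrArg Subtype.val ((map_eq_zero_iff f f.injective).mp h2)
    have hu : (u : V) = 0 := by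
      have : (u : V) ∈ (LinearMap.range φ ⊔ LinearMap.ker φ) ⊓ U := by
        refine ⟨?_, u.2⟩
        have : (u : V) = -x + (x + u) := by abel
        rw [this]
        exact Submodule.add_mem_sup (neg_mem x.2) hxu
      rwa [hU.inf_eq_bot] at this
    have hu' : u = 0 := Subtype.ext hu
    subst hu'
    rw [map_zero, add_zero] at h0'
    have hk : (h k : W) = 0 := by
      have : (h k : W) ∈ (LinearMap.range ψ ⊓ LinearMap.ker ψ) ⊓ K' := by
        refine ⟨⟨?_, hK' (h k).2⟩, (h k).2⟩
        rw [eq_neg_of_add_eq_zero_right h0']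
        exact neg_mem (f x).2
      rwa [hKinf'] at this
    rw [hk, add_zero] at h0'
    have hk' : k = 0 := (map_eq_zero_iff h h.injective).mp (Subtype.ext hk)
    have hx' : x = 0 := (map_eq_zero_iff f f.injective).mp (Subtype.ext h0')
    rw [hk', hx']
    rfl
  let eα : (LinearMap.range φ × K × U) ≃ₗ[F] V := LinearEquiv.ofBijective α ⟨hαinj, hαsurj⟩
  let g : V →ₗ[F] W := γ.comp eα.symm.toLinearMap
  have hginj : Function.Injective g := hγinj.comp eα.symm.injective
  refine ⟨LinearEquiv.ofBijective g
    ⟨hginj, (LinearMap.injective_iff_surjective_of_finrank_eq_finrank hVW).mp hginj⟩, fun v => ?_⟩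
  change g (φ v) = ψ (g v)
  obtain ⟨⟨x, k, u⟩, rfl⟩ := eα.surjective v
  have h1 : g (eα (x, k, u)) = (f x : W) + (h k + g₀ u) := by
    simp [g, γ]
  have h2 : φ (eα (x, k, u)) = eα (rangeRestrictEnd φ x + ⟨φ u, u, rfl⟩, 0, 0) := by
    change φ ((x : V) + (k + u)) = φ x + φ u + (0 + 0)
    simp [hφK]
  have h3 : g (eα (rangeRestrictEnd φ x + ⟨φ u, u, rfl⟩, 0, 0)) =
      (f (rangeRestrictEnd φ x + ⟨φ u, u, rfl⟩) : W) := by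
    simp [g, γ]
  rw [h1, h2, h3, map_add, map_add, map_add, hψK, zero_add, hg₀, hf]
  rfl

universe u v

/-- Over an algebraically closed field, a Frobenius-semilinear endomorphism of a finite-dimensional
space is determined up to isomorphism by the dimensions of the images of its iterates. -/
theorem exists_linearEquiv_of_finrank_iteratedRange_eq {F : Type*} [Field F] [CharP F p]
    [IsAlgClosed F] {V : Type u} [AddCommGroup V] [Module F V] [FiniteDimensional F V]
    {W : Type v} [AddCommGroup W] [Module F W] [FiniteDimensional F W]
    (φ : V →ₛₗ[frobenius F p] V) (ψ : W →ₛₗ[frobenius F p] W)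
    (h : ∀ k, Module.finrank F ↥(iteratedRange φ k) = Module.finrank F ↥(iteratedRange ψ k)) :
    ∃ g : V ≃ₗ[F] W, ∀ v, g (φ v) = ψ (g v) := by
  induction hn : Module.finrank F V using Nat.strong_induction_on generalizing V W with
  | _ n ih =>
  have h0 : Module.finrank F V = Module.finrank F W := by
    rw [← finrank_top F V, ← finrank_top F W]
    exact h 0
  have h1 : Module.finrank F (LinearMap.range φ) = Module.finrank F (LinearMap.range ψ) := by
    rw [LinearMap.range_eq_map φ, LinearMap.range_eq_map ψ]
    exact h 1
  have h2 : Module.finrank F ↥((LinearMap.range φ).map φ) =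
      Module.finrank F ↥((LinearMap.range ψ).map ψ) := by
    rw [LinearMap.range_eq_map φ, LinearMap.range_eq_map ψ]
    exact h 2
  -- Rank–nullity on the whole space and on the range converts the ranks for k = 0, 1, 2 into the
  -- dimensions of ker and of range ∩ ker needed for the extension.
  have hφ := Submodule.finrank_inf_ker_add_finrank_map_frobenius φ ⊤
  have hψ := Submodule.finrank_inf_ker_add_finrank_map_frobenius ψ ⊤
  rw [top_inf_eq, ← LinearMap.range_eq_map, finrank_top] at hφ hψ
  have hφ' := Submodule.finrank_inf_ker_add_finrank_map_frobenius φ (LinearMap.range φ)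
  have hψ' := Submodule.finrank_inf_ker_add_finrank_map_frobenius ψ (LinearMap.range ψ)
  by_cases hlt : Module.finrank F (LinearMap.range φ) < n
  · obtain ⟨f, hf⟩ := ih _ hlt (rangeRestrictEnd φ) (rangeRestrictEnd ψ) (fun k => by
      rw [finrank_iteratedRange_rangeRestrictEnd, finrank_iteratedRange_rangeRestrictEnd, h]) rfl
    exact exists_linearEquiv_of_range_equiv φ ψ h0 (by omega) (by omega) f hf
  · have hk : Module.finrank F (LinearMap.ker φ) = 0 := by omega
    have hk' : Module.finrank F (LinearMap.ker ψ) = 0 := by omega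
    rw [Submodule.finrank_eq_zero] at hk hk'
    exact exists_linearEquiv_of_injective φ (LinearMap.ker_eq_bot.mp hk) ψ
      (LinearMap.ker_eq_bot.mp hk') h0

end SemilinearClassification

/-! ### Reduced monomials modulo relations Xᵢ^p + (lower terms) -/

namespace MvPolynomial

section Triangular

variable {σ F : Type*} [Field F]

/-- The polynomials of total degree less than `d`. -/
noncomputable def degreeLT (σ F : Type*) [Field F] (d : ℕ) : Submodule F (MvPolynomial σ F) :=
  restrictSupport F {s | s.degree < d}

theorem mem_degreeLT {d : ℕ} {f : MvPolynomial σ F} :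
    f ∈ degreeLT σ F d ↔ ∀ s ∈ f.support, s.degree < d := Iff.rfl

theorem degreeLT_mono {d e : ℕ} (h : d ≤ e) : degreeLT σ F d ≤ degreeLT σ F e :=
  restrictSupport_mono _ fun _ hs => lt_of_lt_of_le hs h

theorem eq_zero_of_mem_degreeLT_zero {f : MvPolynomial σ F} (h : f ∈ degreeLT σ F 0) : f = 0 := by
  rw [← support_eq_empty, Finset.eq_empty_iff_forall_notMem]
  exact fun s hs => absurd (mem_degreeLT.mp h s hs) (Nat.not_lt_zero _)

theorem mem_degreeLT_totalDegree (f : MvPolynomial σ F) :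
    f ∈ degreeLT σ F (f.totalDegree + 1) := fun _ hs => Nat.lt_succ_of_le (le_totalDegree hs)

theorem monomial_mem_degreeLT (s : σ →₀ ℕ) (a : F) :
    monomial s a ∈ degreeLT σ F (s.degree + 1) := by
  classical
  intro t ht
  have := Finset.mem_singleton.mp (support_monomial_subset ht)
  subst this
  exact Nat.lt_succ_self _

theorem mul_mem_degreeLT {d e : ℕ} {f g : MvPolynomial σ F} (hf : f ∈ degreeLT σ F d)
    (hg : g ∈ degreeLT σ F (e + 1)) : f * g ∈ degreeLT σ F (d + e) := by
  classical
  intro s hs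
  obtain ⟨a, ha, b, hb, rfl⟩ := Finset.mem_add.mp (support_mul f g hs)
  have h1 := mem_degreeLT.mp hf a ha
  have h2 := mem_degreeLT.mp hg b hb
  change (a + b).degree < d + e
  rw [map_add]
  omega

/-- `f` and `g` have degree at most `d`, with the same homogeneous part of degree `d`. -/
def SameLeading (d : ℕ) (f g : MvPolynomial σ F) : Prop :=
  f ∈ degreeLT σ F (d + 1) ∧ g ∈ degreeLT σ F (d + 1) ∧ f - g ∈ degreeLT σ F d

theorem SameLeading.one : SameLeading 0 (1 : MvPolynomial σ F) 1 :=
  ⟨monomial_mem_degreeLT 0 1, monomial_mem_degreeLT 0 1, by simp⟩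

theorem SameLeading.mul {d e : ℕ} {f g f' g' : MvPolynomial σ F} (h : SameLeading d f g)
    (h' : SameLeading e f' g') : SameLeading (d + e) (f * f') (g * g') := by
  refine ⟨?_, ?_, ?_⟩
  · rw [add_right_comm]
    exact mul_mem_degreeLT h.1 h'.1
  · rw [add_right_comm]
    exact mul_mem_degreeLT h.2.1 h'.2.1
  · have : f * f' - g * g' = (f - g) * f' + (f' - g') * g := by ring
    rw [this]
    refine add_mem (mul_mem_degreeLT h.2.2 h'.1) ?_
    rw [add_comm d e]
    exact mul_mem_degreeLT h'.2.2 h.2.1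

theorem SameLeading.pow {d : ℕ} {f g : MvPolynomial σ F} (h : SameLeading d f g) (n : ℕ) :
    SameLeading (d * n) (f ^ n) (g ^ n) := by
  induction n with
  | zero => simpa using SameLeading.one
  | succ n ih => simpa [pow_succ, mul_add] using ih.mul h

theorem SameLeading.prod {ι : Type*} (s : Finset ι) {d : ι → ℕ} {f g : ι → MvPolynomial σ F}
    (h : ∀ i ∈ s, SameLeading (d i) (f i) (g i)) :
    SameLeading (∑ i ∈ s, d i) (∏ i ∈ s, f i) (∏ i ∈ s, g i) := by
  classical
  induction s using Finset.induction_on with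
  | empty => simpa using SameLeading.one
  | insert a s ha ih =>
    rw [Finset.sum_insert ha, Finset.prod_insert ha, Finset.prod_insert ha]
    exact (h a (Finset.mem_insert_self a s)).mul
      (ih fun i hi => h i (Finset.mem_insert_of_mem hi))

variable (p : ℕ) (r : σ → MvPolynomial σ F)

/-- The product of the `rᵢ ^ (δᵢ / p) * Xᵢ ^ (δᵢ % p)`. -/
noncomputable def divModProd (δ : σ →₀ ℕ) : MvPolynomial σ F :=
  δ.prod fun i k => r i ^ (k / p) * X i ^ (k % p)

/-- The linear map sending the monomial with exponent `δ` to `divModProd p r δ`. -/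
noncomputable def divModMap : MvPolynomial σ F →ₗ[F] MvPolynomial σ F :=
  (basisMonomials σ F).constr F (divModProd p r)

theorem divModMap_monomial_one (δ : σ →₀ ℕ) :
    divModMap p r (monomial δ 1) = divModProd p r δ := by
  simpa only [divModMap, coe_basisMonomials] using
    (basisMonomials σ F).constr_basis F (divModProd p r) δ

theorem divModMap_apply (f : MvPolynomial σ F) :
    divModMap p r f = ∑ s ∈ f.support, f.coeff s • divModProd p r s := by
  conv_lhs => rw [f.as_sum, map_sum]
  refine Finset.sum_congr rfl fun s _ => ?_
  rw [← divModMap_monomial_one, ← map_smul, smul_monomial, smul_eq_mul, mul_one]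

theorem divModProd_of_lt {δ : σ →₀ ℕ} (h : ∀ i, δ i < p) :
    divModProd p r δ = monomial δ 1 := by
  rw [monomial_eq, C_1, one_mul, divModProd]
  refine Finset.prod_congr rfl fun i _ => ?_
  dsimp only
  rw [Nat.div_eq_of_lt (h i), Nat.mod_eq_of_lt (h i), pow_zero, one_mul]

theorem divModMap_of_lt {f : MvPolynomial σ F} (h : ∀ s ∈ f.support, ∀ i, s i < p) :
    divModMap p r f = f := by
  rw [divModMap_apply]
  conv_rhs => rw [f.as_sum]
  refine Finset.sum_congr rfl fun s hs => ?_
  rw [divModProd_of_lt p r (h s hs), smul_monomial, smul_eq_mul, mul_one]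

variable {p}

theorem divModProd_add_single (hp : 0 < p) (δ : σ →₀ ℕ) (i : σ) :
    divModProd p r (δ + Finsupp.single i p) = divModProd p r δ * r i := by
  classical
  have h0 : ∀ j ∈ insert i δ.support, r j ^ (0 / p) * X j ^ (0 % p) = 1 := by simp
  rw [divModProd, divModProd,
    Finsupp.prod_of_support_subset δ (Finset.subset_insert i _) _ h0,
    Finsupp.prod_of_support_subset (δ + Finsupp.single i p) (s := insert i δ.support) ?_ _ h0,
    ← Finset.mul_prod_erase _ _ (Finset.mem_insert_self i δ.support),
    ← Finset.mul_prod_erase _ _ (Finset.mem_insert_self i δ.support)]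
  · have h1 : ∏ j ∈ (insert i δ.support).erase i, r j ^ ((δ + Finsupp.single i p) j / p) *
        X j ^ ((δ + Finsupp.single i p) j % p) =
        ∏ j ∈ (insert i δ.support).erase i, r j ^ (δ j / p) * X j ^ (δ j % p) := by
      refine Finset.prod_congr rfl fun j hj => ?_
      rw [Finsupp.add_apply, Finsupp.single_eq_of_ne (Finset.ne_of_mem_erase hj), add_zero]
    rw [h1, Finsupp.add_apply, Finsupp.single_eq_same, Nat.add_div_right _ hp, Nat.add_mod_right,
      pow_succ]
    ring
  · intro j hj
    rw [Finset.mem_insert, Finsupp.mem_support_iff]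
    by_contra! hne
    rw [Finsupp.mem_support_iff, Finsupp.add_apply, hne.2, Finsupp.single_eq_of_ne hne.1] at hj
    exact hj rfl

/-- The purpose of `divModMap`: although not multiplicative, it intertwines multiplication by Xᵢ^p
with multiplication by rᵢ. Being bijective, it matches the monomial ideal of the Xᵢ^p with the ideal
of the rᵢ, and it fixes reduced polynomials. -/
theorem divModMap_mul_X_pow (hp : 0 < p) (f : MvPolynomial σ F) (i : σ) :
    divModMap p r (f * X i ^ p) = divModMap p r f * r i := by
  have : (divModMap p r).comp (LinearMap.mulRight F (X i ^ p)) =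
      (LinearMap.mulRight F (r i)).comp (divModMap p r) := by
    refine (basisMonomials σ F).ext fun δ => ?_
    simp only [coe_basisMonomials, LinearMap.comp_apply, LinearMap.mulRight_apply,
      divModMap_monomial_one, ← divModProd_add_single r hp]
    rw [X_pow_eq_monomial, monomial_mul, mul_one, divModMap_monomial_one]
  exact LinearMap.congr_fun this f

variable {r}

theorem sameLeading_divModProd (hr : ∀ i, r i - X i ^ p ∈ degreeLT σ F p) (δ : σ →₀ ℕ) :
    SameLeading δ.degree (divModProd p r δ) (monomial δ 1) := by
  have hX : ∀ (i : σ) (k : ℕ), (X i ^ k : MvPolynomial σ F) ∈ degreeLT σ F (k + 1) := by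
    intro i k
    simpa [X_pow_eq_monomial] using monomial_mem_degreeLT (Finsupp.single i k) (1 : F)
  have hX1 : ∀ i k, SameLeading k (X i ^ k : MvPolynomial σ F) (X i ^ k) := fun i k =>
    ⟨hX i k, hX i k, by simp⟩
  have hr1 : ∀ i, SameLeading p (r i) (X i ^ p) := fun i =>
    ⟨by simpa using add_mem (degreeLT_mono (Nat.le_succ p) (hr i)) (hX i p), hX i p, hr i⟩
  rw [monomial_eq, C_1, one_mul, divModProd]
  refine SameLeading.prod _ fun i _ => ?_
  have := ((hr1 i).pow (δ i / p)).mul (hX1 i (δ i % p))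
  rwa [← pow_mul, ← pow_add, Nat.div_add_mod] at this

/-- `divModMap` is unitriangular for the degree filtration, since each product has the same leading
form as its monomial; both injectivity and surjectivity follow by induction on the degree. -/
theorem divModMap_sub_mem (hr : ∀ i, r i - X i ^ p ∈ degreeLT σ F p) {d : ℕ}
    {f : MvPolynomial σ F} (hf : f ∈ degreeLT σ F (d + 1)) :
    divModMap p r f - f ∈ degreeLT σ F d := by
  have : divModMap p r f - f =
      ∑ s ∈ f.support, f.coeff s • (divModProd p r s - monomial s 1) := by
    simp only [smul_sub, Finset.sum_sub_distrib, smul_monomial, smul_eq_mul, mul_one]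
    rw [← f.as_sum, ← divModMap_apply]
  rw [this]
  exact sum_mem fun s hs => Submodule.smul_mem _ _
    (degreeLT_mono (Nat.le_of_lt_succ (mem_degreeLT.mp hf s hs)) (sameLeading_divModProd hr s).2.2)

theorem divModMap_injective (hr : ∀ i, r i - X i ^ p ∈ degreeLT σ F p) :
    Function.Injective (divModMap p r) := by
  rw [injective_iff_map_eq_zero]
  intro f hf
  have key : ∀ d, f ∈ degreeLT σ F d → f = 0 := by
    intro d
    induction d with
    | zero => exact eq_zero_of_mem_degreeLT_zero
    | succ d ih =>
      intro h
      have := divModMap_sub_mem hr h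
      rw [hf, zero_sub, neg_mem_iff] at this
      exact ih this
  exact key _ (mem_degreeLT_totalDegree f)

theorem divModMap_surjective (hr : ∀ i, r i - X i ^ p ∈ degreeLT σ F p) :
    Function.Surjective (divModMap p r) := by
  have key : ∀ d, degreeLT σ F d ≤ LinearMap.range (divModMap p r) := by
    intro d
    induction d with
    | zero =>
      intro f hf
      rw [eq_zero_of_mem_degreeLT_zero hf]
      exact zero_mem _
    | succ d ih =>
      intro f hf
      have := sub_mem (LinearMap.mem_range_self (divModMap p r) f) (ih (divModMap_sub_mem hr hf))
      simpa using this
  exact fun f => key _ (mem_degreeLT_totalDegree f)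

/-- The reduced monomials (those with all exponents less than `p`) are linearly independent modulo
an ideal generated by polynomials `Xᵢ ^ p + (terms of degree less than p)`. -/
theorem eq_zero_of_mem_span_of_lt (hp : 0 < p) (hr : ∀ i, r i - X i ^ p ∈ degreeLT σ F p)
    {f : MvPolynomial σ F} (hf : f ∈ Ideal.span (Set.range r)) (h : ∀ s ∈ f.support, ∀ i, s i < p) :
    f = 0 := by
  have key : ∀ g ∈ Ideal.span (Set.range r), ∃ g' ∈ Ideal.span
      ((fun s => monomial s (1 : F)) '' Set.range fun i : σ => Finsupp.single i p),
      divModMap p r g' = g := by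
    intro g hg
    induction hg using Submodule.closure_induction with
    | zero => exact ⟨0, zero_mem _, map_zero _⟩
    | add x y _ _ hx hy =>
      obtain ⟨x', hx', rfl⟩ := hx
      obtain ⟨y', hy', rfl⟩ := hy
      exact ⟨x' + y', add_mem hx' hy', map_add _ _ _⟩
    | smul_mem a x hx =>
      obtain ⟨i, rfl⟩ := hx
      -- Surjectivity allows any coefficient of rᵢ to be written as an image, so that the multiple
      -- of rᵢ is the image of a multiple of Xᵢ^p.
      obtain ⟨a, rfl⟩ := divModMap_surjective hr a
      refine ⟨a * X i ^ p, Ideal.mul_mem_left _ _ (Ideal.subset_span ?_),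
        divModMap_mul_X_pow r hp a i⟩
      exact ⟨_, ⟨i, rfl⟩, (X_pow_eq_monomial).symm⟩
  obtain ⟨g, hg, hgf⟩ := key f hf
  have : g = f := divModMap_injective hr (hgf.trans (divModMap_of_lt p r h).symm)
  subst this
  rw [← support_eq_empty, Finset.eq_empty_iff_forall_notMem]
  intro s hs
  obtain ⟨_, ⟨i, rfl⟩, hi⟩ := mem_ideal_span_monomial_image.mp hg s hs
  have h1 := hi i
  rw [Finsupp.single_eq_same] at h1
  exact absurd (h s hs i) (not_lt.mpr h1)

/-- Modulo polynomials `Xᵢ ^ p + (terms of degree less than p)`, every polynomial is a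
combination of reduced monomials. -/
theorem aeval_mem_span_of_lt (hp : 0 < p) (hr : ∀ i, r i - X i ^ p ∈ degreeLT σ F p)
    {A : Type*} [CommRing A] [Algebra F A] (x : σ → A) (hx : ∀ i, aeval x (r i) = 0)
    (f : MvPolynomial σ F) :
    aeval x f ∈ Submodule.span F
      ((fun δ : σ →₀ ℕ => δ.prod fun i k => x i ^ k) '' {δ | ∀ i, δ i < p}) := by
  -- Once f is an image under `divModMap`, every non-reduced exponent contributes a factor rᵢ, which
  -- vanishes at `x`.
  obtain ⟨f, rfl⟩ := divModMap_surjective hr f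
  rw [divModMap_apply, map_sum]
  refine sum_mem fun s _ => ?_
  rw [map_smul]
  refine Submodule.smul_mem _ _ ?_
  by_cases h : ∀ i, s i < p
  · rw [divModProd_of_lt p r h, aeval_monomial, map_one, one_mul]
    exact Submodule.subset_span ⟨s, h, rfl⟩
  · push Not at h
    obtain ⟨i, hi⟩ := h
    have : aeval x (divModProd p r s) = 0 := by
      rw [divModProd, Finsupp.prod, map_prod]
      refine Finset.prod_eq_zero (i := i) (Finsupp.mem_support_iff.mpr (by omega)) ?_
      rw [map_mul, map_pow, hx, zero_pow (Nat.div_pos hi hp).ne', zero_mul]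
    rw [this]
    exact zero_mem _

end Triangular

end MvPolynomial

/-! ### p-th powers in algebras of characteristic p -/

section CharPAlgebra

variable {p : ℕ} [Fact p.Prime] (F : Type*) [Field F] [CharP F p] {A : Type*}

theorem add_pow_char_of_commute_of_algebra [Ring A] [Algebra F A] {x y : A} (h : Commute x y) :
    (x + y) ^ p = x ^ p + y ^ p := by
  -- The zero algebra does not have characteristic p, so it is treated apart.
  rcases subsingleton_or_nontrivial A with _ | _
  · exact Subsingleton.elim _ _
  · have : CharP A p := charP_of_injective_algebraMap (algebraMap F A).injective p
    exact add_pow_char_of_commute p h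

variable {F} [CommRing A] [Algebra F A] {V : Type*} [AddCommGroup V] [Module F V]

/-- The `p`-th power of a linear map to a commutative algebra, as a semilinear map. -/
def linearPowChar (f : V →ₗ[F] A) :
    V →ₛₗ[frobenius F p] A where
  toFun v := f v ^ p
  map_add' x y := by
    rw [map_add, add_pow_char_of_commute_of_algebra F (Commute.all _ _)]
  map_smul' a x := by
    rw [map_smul, smul_pow, frobenius_def]

theorem pow_eq_of_basis {ι : Type*} (b : Module.Basis ι F V) (φ : V →ₛₗ[frobenius F p] V)
    (f : V →ₗ[F] A) (h : ∀ i, f (b i) ^ p = f (φ (b i))) (v : V) : f v ^ p = f (φ v) := by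
  have : linearPowChar f = f.comp φ := b.ext h
  exact LinearMap.congr_fun this v

theorem pow_pow_eq_iterate {φ : V →ₛₗ[frobenius F p] V} {f : V →ₗ[F] A}
    (h : ∀ v, f v ^ p = f (φ v)) (k : ℕ) (v : V) : f v ^ p ^ k = f (φ^[k] v) := by
  induction k with
  | zero => simp
  | succ k ih => rw [pow_succ, pow_mul, ih, h, Function.iterate_succ_apply']

end CharPAlgebra

/-! ### The commutative algebra with relations v^p = φ(v) -/

section FrobeniusAlgebra

open MvPolynomial

variable {p : ℕ} [Fact p.Prime] {F : Type*} [Field F] [CharP F p]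
  {V : Type*} [AddCommGroup V] [Module F V] {ι : Type*}

/-- The linear form in the variables `Xᵢ` with the coordinates of a vector as coefficients. -/
noncomputable def linearForm (b : Module.Basis ι F V) : V →ₗ[F] MvPolynomial ι F :=
  b.constr F X

theorem linearForm_basis (b : Module.Basis ι F V) (i : ι) : linearForm b (b i) = X i :=
  b.constr_basis F X i

theorem exists_eq_single_of_mem_support_linearForm (b : Module.Basis ι F V) (v : V) :
    ∀ s ∈ (linearForm b v).support, ∃ i, s = Finsupp.single i 1 := by
  classical
  intro s hs
  rw [linearForm, Module.Basis.constr_apply, Finsupp.sum, mem_support_iff, coeff_sum] at hs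
  obtain ⟨i, _, hi⟩ := Finset.exists_ne_zero_of_sum_ne_zero hs
  rw [coeff_smul, coeff_X] at hi
  by_cases h : Finsupp.single i 1 = s
  · exact ⟨i, h.symm⟩
  · rw [if_neg h, smul_zero] at hi
    exact absurd rfl hi

theorem linearForm_injective (b : Module.Basis ι F V) : Function.Injective (linearForm b) := by
  rw [← LinearMap.ker_eq_bot]
  have hli : LinearIndependent F (X : ι → MvPolynomial ι F) := by
    have := (basisMonomials ι F).linearIndependent.comp (fun i : ι => Finsupp.single i 1)
      (Finsupp.single_left_injective one_ne_zero)
    exact this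
  exact LinearMap.ker_eq_bot.mpr (b.injective_constr_of_linearIndependent hli)

/-- The relation `Xᵢ ^ p = φ(bᵢ)`, as a polynomial. -/
noncomputable def frobeniusRelation (φ : V →ₛₗ[frobenius F p] V) (b : Module.Basis ι F V) (i : ι) :
    MvPolynomial ι F :=
  X i ^ p - linearForm b (φ (b i))

theorem frobeniusRelation_sub_mem (φ : V →ₛₗ[frobenius F p] V) (b : Module.Basis ι F V) (i : ι) :
    frobeniusRelation φ b i - X i ^ p ∈ degreeLT ι F p := by
  rw [frobeniusRelation, sub_sub_cancel_left, neg_mem_iff]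
  intro s hs
  obtain ⟨j, rfl⟩ := exists_eq_single_of_mem_support_linearForm b _ s hs
  change (Finsupp.single j 1).degree < p
  rw [Finsupp.degree_single]
  exact (Fact.out : p.Prime).one_lt

/-- The commutative algebra generated by the space `V` with the relations `v ^ p = φ(v)`, presented
by a basis of `V`. -/
abbrev FrobeniusAlgebra (φ : V →ₛₗ[frobenius F p] V) (b : Module.Basis ι F V) : Type _ :=
  MvPolynomial ι F ⧸ Ideal.span (Set.range (frobeniusRelation φ b))

namespace FrobeniusAlgebra

variable (φ : V →ₛₗ[frobenius F p] V) (b : Module.Basis ι F V)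

/-- The canonical map from the space to the algebra. -/
noncomputable def of : V →ₗ[F] FrobeniusAlgebra φ b :=
  (Ideal.Quotient.mkₐ F (Ideal.span (Set.range (frobeniusRelation φ b)))).toLinearMap.comp
    (linearForm b)

theorem of_basis (i : ι) : of φ b (b i) =
    Ideal.Quotient.mkₐ F (Ideal.span (Set.range (frobeniusRelation φ b))) (X i) := by
  simp [of, linearForm_basis]

theorem of_pow (v : V) : of φ b v ^ p = of φ b (φ v) := by
  refine pow_eq_of_basis b φ (of φ b) (fun i => ?_) v
  rw [of_basis, ← map_pow, ← sub_eq_zero, of, LinearMap.comp_apply, AlgHom.toLinearMap_apply,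
    ← map_sub]
  exact Ideal.Quotient.eq_zero_iff_mem.mpr (Ideal.subset_span ⟨i, rfl⟩)

/-- A linear form is a reduced polynomial because 1 < p, so it lies in the ideal of relations only
if it is zero. -/
theorem of_injective : Function.Injective (of φ b) := by
  rw [injective_iff_map_eq_zero]
  intro v hv
  have hp := (Fact.out : p.Prime).one_lt
  have h1 : linearForm b v = 0 := by
    refine eq_zero_of_mem_span_of_lt (by omega) (frobeniusRelation_sub_mem φ b)
      (Ideal.Quotient.eq_zero_iff_mem.mp hv) fun s hs i => ?_
    obtain ⟨j, rfl⟩ := exists_eq_single_of_mem_support_linearForm b _ s hs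
    exact ((Finsupp.le_degree i _).trans_eq (Finsupp.degree_single j 1)).trans_lt hp
  exact (map_eq_zero_iff _ (linearForm_injective b)).mp h1

theorem adjoin_range_of : Algebra.adjoin F (Set.range (of φ b)) = ⊤ := by
  rw [eq_top_iff]
  have h : (⊤ : Subalgebra F (FrobeniusAlgebra φ b)) =
      (Algebra.adjoin F (Set.range X)).map (Ideal.Quotient.mkₐ F
        (Ideal.span (Set.range (frobeniusRelation φ b)))) := by
    rw [adjoin_range_X, Algebra.map_top, eq_comm, AlgHom.range_eq_top]
    exact Ideal.Quotient.mkₐ_surjective F _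
  rw [h, AlgHom.map_adjoin]
  refine Algebra.adjoin_mono ?_
  rintro _ ⟨_, ⟨i, rfl⟩, rfl⟩
  exact ⟨b i, of_basis φ b i⟩

theorem linearIndependent_reducedMonomials :
    LinearIndependent F (fun δ : {δ : ι →₀ ℕ // ∀ i, δ i < p} =>
      δ.1.prod fun i k => of φ b (b i) ^ k) := by
  let I := Ideal.span (Set.range (frobeniusRelation φ b))
  have h1 : (fun δ : {δ : ι →₀ ℕ // ∀ i, δ i < p} => δ.1.prod fun i k => of φ b (b i) ^ k) =
      (Ideal.Quotient.mkₐ F I).toLinearMap ∘ (fun δ => monomial δ.1 (1 : F)) := by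
    funext δ
    rw [Function.comp_apply, AlgHom.toLinearMap_apply, monomial_eq, C_1, one_mul, Finsupp.prod,
      Finsupp.prod, map_prod]
    refine Finset.prod_congr rfl fun i _ => ?_
    rw [of_basis, map_pow]
  rw [h1]
  have h2 : LinearIndependent F (fun δ : {δ : ι →₀ ℕ // ∀ i, δ i < p} => monomial δ.1 (1 : F)) :=
    (basisMonomials ι F).linearIndependent.comp _ Subtype.val_injective
  refine h2.map ?_
  rw [Submodule.disjoint_def]
  intro f hf hf'
  refine eq_zero_of_mem_span_of_lt (Fact.out : p.Prime).pos (frobeniusRelation_sub_mem φ b)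
    (Ideal.Quotient.eq_zero_iff_mem.mp hf') ?_
  have h3 : Submodule.span F (Set.range fun δ : {δ : ι →₀ ℕ // ∀ i, δ i < p} =>
      monomial δ.1 (1 : F)) ≤ restrictSupport F {δ | ∀ i, δ i < p} := by
    rw [restrictSupport_eq_span]
    refine Submodule.span_mono ?_
    rintro _ ⟨δ, rfl⟩
    exact ⟨δ.1, δ.2, rfl⟩
  exact fun s hs => h3 hf hs

/-- The universal property, for algebras that are commutative as a hypothesis. -/
theorem exists_algHom {A : Type*} [Ring A] [Algebra F A] (hA : ∀ x y : A, x * y = y * x)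
    (f : V →ₗ[F] A) (hf : ∀ v, f v ^ p = f (φ v)) :
    ∃ g : FrobeniusAlgebra φ b →ₐ[F] A, ∀ v, g (of φ b v) = f v := by
  let _ : CommRing A := { (inferInstance : Ring A) with mul_comm := hA }
  have hlin : ∀ v, aeval (fun i => f (b i)) (linearForm b v) = f v := by
    intro v
    have : (aeval (fun i => f (b i))).toLinearMap.comp (linearForm b) = f :=
      b.ext fun i => by simp [linearForm_basis]
    exact LinearMap.congr_fun this v
  refine ⟨Ideal.Quotient.liftₐ _ (aeval fun i => f (b i)) fun a ha => ?_, fun v => ?_⟩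
  · have : Ideal.span (Set.range (frobeniusRelation φ b)) ≤
        RingHom.ker (aeval (R := F) fun i => f (b i)) := by
      rw [Ideal.span_le]
      rintro _ ⟨i, rfl⟩
      simp [frobeniusRelation, hlin, hf]
    exact this ha
  · exact hlin v

end FrobeniusAlgebra

end FrobeniusAlgebra

/-! ### Dimensions of the spans of p^k-th powers -/

section PowSpan

universe u

variable {p : ℕ} [Fact p.Prime] {F : Type*} [Field F] [CharP F p]

theorem add_pow_char_pow_of_algebra (F : Type*) [Field F] [CharP F p] {A : Type*} [CommRing A]
    [Algebra F A] (k : ℕ) (x y : A) : (x + y) ^ p ^ k = x ^ p ^ k + y ^ p ^ k := by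
  induction k with
  | zero => simp
  | succ k ih =>
    rw [pow_succ, pow_mul, pow_mul, pow_mul, ih,
      add_pow_char_of_commute_of_algebra F (Commute.all _ _)]

/-- The subspace of an algebra spanned by the `n`-th powers. -/
def powSpan (F A : Type*) [Field F] [Ring A] [Algebra F A] (n : ℕ) : Submodule F A :=
  Submodule.span F (Set.range fun a : A => a ^ n)

theorem powSpan_one (F A : Type*) [Field F] [Ring A] [Algebra F A] : powSpan F A 1 = ⊤ :=
  eq_top_iff.mpr fun a _ => Submodule.subset_span ⟨a, pow_one a⟩

theorem finrank_powSpan_eq_of_algEquiv {A B : Type*} [Ring A] [Algebra F A] [Ring B] [Algebra F B]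
    (e : A ≃ₐ[F] B) (n : ℕ) :
    Module.finrank F (powSpan F A n) = Module.finrank F (powSpan F B n) := by
  have : powSpan F B n = (powSpan F A n).map e.toLinearEquiv.toLinearMap := by
    rw [powSpan, powSpan, Submodule.map_span]
    congr 1
    ext b
    constructor
    · rintro ⟨x, rfl⟩
      exact ⟨_, ⟨e.symm x, rfl⟩, by simp⟩
    · rintro ⟨_, ⟨x, rfl⟩, rfl⟩
      exact ⟨e x, by simp⟩
  rw [this]
  exact (e.toLinearEquiv.submoduleMap _).finrank_eq

variable {V : Type*} [AddCommGroup V] [Module F V]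

/-- The subalgebra generated by a `φ`-stable subspace is spanned by the reduced monomials in a basis
of this subspace. -/
theorem adjoin_le_span_reducedMonomials {A : Type*} [CommRing A] [Algebra F A]
    {φ : V →ₛₗ[frobenius F p] V} {f : V →ₗ[F] A} (hf : ∀ v, f v ^ p = f (φ v))
    {N : Submodule F V} (hN : ∀ v ∈ N, φ v ∈ N) {n : ℕ} (b : Module.Basis (Fin n) F N) :
    Subalgebra.toSubmodule (Algebra.adjoin F (f '' N)) ≤
      Submodule.span F (Set.range fun α : Fin n → Fin p => ∏ i, f (b i) ^ (α i : ℕ)) := by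
  let φN : N →ₛₗ[frobenius F p] N :=
    { toFun := fun x => ⟨φ x, hN x x.2⟩
      map_add' := fun x y => Subtype.ext (map_add φ (x : V) y)
      map_smul' := fun a x => Subtype.ext (map_smulₛₗ φ a (x : V)) }
  have hlin : ∀ v : N, MvPolynomial.aeval (fun i => f (b i)) (linearForm b v) = f v := by
    intro v
    have : (MvPolynomial.aeval (fun i => f (b i))).toLinearMap.comp (linearForm b) =
        f.comp N.subtype := b.ext fun i => by simp [linearForm_basis]
    exact LinearMap.congr_fun this v
  intro x hx
  have hx' : x ∈ (MvPolynomial.aeval (R := F) fun i => f (b i)).range := by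
    refine (Algebra.adjoin_le ?_ : Algebra.adjoin F (f '' N) ≤ _) hx
    rintro _ ⟨v, hv, rfl⟩
    exact ⟨linearForm b ⟨v, hv⟩, hlin ⟨v, hv⟩⟩
  obtain ⟨g, rfl⟩ := hx'
  have := MvPolynomial.aeval_mem_span_of_lt (Fact.out : p.Prime).pos
    (frobeniusRelation_sub_mem φN b) (fun i => f (b i))
    (fun i => by simp [frobeniusRelation, hlin, hf, φN]) g
  refine Submodule.span_mono ?_ this
  rintro _ ⟨δ, hδ, rfl⟩
  refine ⟨fun i => ⟨δ i, hδ i⟩, ?_⟩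
  dsimp only
  rw [Finsupp.prod_fintype _ _ fun i => pow_zero _]

/-- Only the basis vectors selected by `e` occur; this serves for a basis of V extending a basis of
a subspace. -/
theorem FrobeniusAlgebra.linearIndependent_prod_pow {ι κ : Type*} [Fintype κ]
    (φ : V →ₛₗ[frobenius F p] V) (b : Module.Basis ι F V) (e : κ ↪ ι) :
    LinearIndependent F (fun α : κ → Fin p => ∏ i, of φ b (b (e i)) ^ (α i : ℕ)) := by
  classical
  let E : (κ → Fin p) → {δ : ι →₀ ℕ // ∀ i, δ i < p} := fun α =>
    ⟨(Finsupp.equivFunOnFinite.symm fun i => (α i : ℕ)).embDomain e, fun i => by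
      by_cases h : i ∈ Set.range e
      · obtain ⟨j, rfl⟩ := h
        rw [Finsupp.embDomain_apply_self]
        exact (α j).2
      · rw [Finsupp.embDomain_of_notMem_range _ _ _ h]
        exact (Fact.out : p.Prime).pos⟩
  have hE : Function.Injective E := by
    intro α β h
    have h1 := Finsupp.equivFunOnFinite.symm.injective
      (Finsupp.embDomain_injective e (congrArg Subtype.val h))
    funext i
    exact Fin.ext (congrFun h1 i)
  have := (linearIndependent_reducedMonomials φ b).comp E hE
  convert this using 1
  funext α
  rw [Function.comp_apply, Finsupp.prod_embDomain, Finsupp.prod_fintype _ _ fun i => pow_zero _]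
  rfl

variable [PerfectRing F p]

/-- The p^k-th power map is additive and multiplicative and sends f(v) to f(φ^k(v)), so its values
lie in the subalgebra generated by the image of φ^k. Conversely, each basis vector of that image is
some φ^k(y), so a reduced monomial in these vectors is the p^k-th power of a monomial in the y. -/
theorem powSpan_eq_span_reducedMonomials {A : Type*} [CommRing A] [Algebra F A]
    {φ : V →ₛₗ[frobenius F p] V} {f : V →ₗ[F] A} (hf : ∀ v, f v ^ p = f (φ v))
    (htop : Algebra.adjoin F (Set.range f) = ⊤) (k : ℕ) {n : ℕ}
    (b : Module.Basis (Fin n) F (iteratedRange φ k)) :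
    powSpan F A (p ^ k) =
      Submodule.span F (Set.range fun α : Fin n → Fin p => ∏ i, f (b i) ^ (α i : ℕ)) := by
  apply le_antisymm
  · refine le_trans ?_ (adjoin_le_span_reducedMonomials hf (N := iteratedRange φ k) ?_ b)
    · refine Submodule.span_le.mpr ?_
      rintro _ ⟨a, rfl⟩
      have ha : a ∈ Algebra.adjoin F (Set.range f) := htop ▸ Algebra.mem_top
      change a ^ p ^ k ∈ Algebra.adjoin F (f '' (iteratedRange φ k))
      induction ha using Algebra.adjoin_induction with
      | mem x hx =>
        obtain ⟨v, rfl⟩ := hx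
        rw [pow_pow_eq_iterate hf]
        exact Algebra.subset_adjoin ⟨_, mem_iteratedRange.mpr ⟨v, rfl⟩, rfl⟩
      | algebraMap r =>
        rw [← map_pow]
        exact Subalgebra.algebraMap_mem _ _
      | add x y _ _ hx hy =>
        rw [add_pow_char_pow_of_algebra F]
        exact add_mem hx hy
      | mul x y _ _ hx hy =>
        rw [mul_pow]
        exact mul_mem hx hy
    · intro v hv
      obtain ⟨w, rfl⟩ := mem_iteratedRange.mp hv
      refine mem_iteratedRange.mpr ⟨φ w, ?_⟩
      rw [← Function.iterate_succ_apply, Function.iterate_succ_apply']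
  · refine Submodule.span_le.mpr ?_
    rintro _ ⟨α, rfl⟩
    choose y hy using fun i => mem_iteratedRange.mp (b i).2
    refine Submodule.subset_span ⟨∏ i, f (y i) ^ (α i : ℕ), ?_⟩
    dsimp only
    rw [← Finset.prod_pow]
    refine Finset.prod_congr rfl fun i _ => ?_
    rw [← hy, ← pow_pow_eq_iterate hf, pow_right_comm]

/-- The algebra attached to `φ` determines the dimensions of the images of the iterates of `φ`. -/
theorem exists_basis_finrank_powSpan {V : Type u} [AddCommGroup V] [Module F V]
    [FiniteDimensional F V] (φ : V →ₛₗ[frobenius F p] V) (k : ℕ) :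
    ∃ (ι : Type u) (b : Module.Basis ι F V),
      Module.finrank F (powSpan F (FrobeniusAlgebra φ b) (p ^ k)) =
        p ^ Module.finrank F (iteratedRange φ k) := by
  let bN := Module.finBasis F (iteratedRange φ k)
  have hli : LinearIndependent F (fun i => (bN i : V)) :=
    bN.linearIndependent.map' (iteratedRange φ k).subtype (Submodule.ker_subtype _)
  let b := Module.Basis.extend hli.linearIndepOn_id
  have hsub := hli.linearIndepOn_id.subset_extend (Set.subset_univ _)
  let e : Fin (Module.finrank F (iteratedRange φ k)) ↪
      hli.linearIndepOn_id.extend (Set.subset_univ _) :=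
    ⟨fun i => ⟨bN i, hsub ⟨i, rfl⟩⟩, fun i j h => hli.injective (by simpa using h)⟩
  have hb : ∀ i, b (e i) = bN i := fun i => Module.Basis.extend_apply_self _ _
  refine ⟨_, b, ?_⟩
  rw [powSpan_eq_span_reducedMonomials (FrobeniusAlgebra.of_pow φ b)
    (FrobeniusAlgebra.adjoin_range_of φ b) k bN]
  have hind := FrobeniusAlgebra.linearIndependent_prod_pow φ b e
  simp only [hb] at hind
  rw [finrank_span_eq_card hind]
  simp

theorem FrobeniusAlgebra.finiteDimensional [FiniteDimensional F V] {ι : Type*}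
    (φ : V →ₛₗ[frobenius F p] V) (b : Module.Basis ι F V) :
    FiniteDimensional F (FrobeniusAlgebra φ b) := by
  -- For k = 0 the powers are all elements, so finitely many reduced monomials span the algebra.
  have h := powSpan_eq_span_reducedMonomials (of_pow φ b) (adjoin_range_of φ b) 0
    (Module.finBasis F (iteratedRange φ 0))
  rw [pow_zero, powSpan_one] at h
  exact ⟨h ▸ Submodule.fg_span (Set.finite_range _)⟩

end PowSpan

/-! ### Restricted enveloping algebras and the abelian case -/

namespace RestrictedEnvelopingAlgebra

section

attribute [local instance] LieRing.ofAssociativeRing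

variable (p : ℕ) (F : Type*) [Field F] (L : Type*) [LieRing L] [LieAlgebra F L]
  [RestrictedLieAlgebra p F L]

/-- The canonical map from a restricted Lie algebra to its restricted enveloping algebra. -/
noncomputable def ι : L →ₗ[F] RestrictedEnvelopingAlgebra p F L :=
  (RingQuot.mkAlgHom F (Rel p F L)).toLinearMap.comp
    (UniversalEnvelopingAlgebra.ι F : L →ₗ⁅F⁆ UniversalEnvelopingAlgebra F L).toLinearMap

variable {L}

theorem ι_apply (x : L) :
    ι p F L x = RingQuot.mkAlgHom F (Rel p F L) (UniversalEnvelopingAlgebra.ι F x) := rfl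

theorem ι_lie (x y : L) : ι p F L ⁅x, y⁆ = ι p F L x * ι p F L y - ι p F L y * ι p F L x := by
  simp only [ι_apply]
  rw [LieHom.map_lie, LieRing.of_associative_ring_bracket, map_sub, map_mul, map_mul]

theorem ι_pow (x : L) : ι p F L x ^ p = ι p F L (RestrictedLieAlgebra.pMap p F x) := by
  rw [ι_apply, ι_apply, ← map_pow]
  exact RingQuot.mkAlgHom_rel F (Rel.pow_p x)

variable {p F} {A : Type*} [Ring A] [Algebra F A]

/-- The universal property of the restricted enveloping algebra. -/
theorem exists_algHom (f : L →ₗ[F] A) (hlie : ∀ x y, f ⁅x, y⁆ = f x * f y - f y * f x)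
    (hf : ∀ x, f x ^ p = f (RestrictedLieAlgebra.pMap p F x)) :
    ∃ g : RestrictedEnvelopingAlgebra p F L →ₐ[F] A, ∀ x, g (ι p F L x) = f x := by
  let f' : L →ₗ⁅F⁆ A := { f with map_lie' := fun {x y} => hlie x y }
  refine ⟨RingQuot.liftAlgHom F ⟨UniversalEnvelopingAlgebra.lift F f', ?_⟩, fun x => ?_⟩
  · rintro _ _ ⟨x⟩
    rw [map_pow, UniversalEnvelopingAlgebra.lift_ι_apply, UniversalEnvelopingAlgebra.lift_ι_apply]
    exact hf x
  · rw [ι_apply, RingQuot.liftAlgHom_mkAlgHom_apply, UniversalEnvelopingAlgebra.lift_ι_apply]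
    rfl

theorem hom_ext {g₁ g₂ : RestrictedEnvelopingAlgebra p F L →ₐ[F] A}
    (h : ∀ x, g₁ (ι p F L x) = g₂ (ι p F L x)) : g₁ = g₂ := by
  refine RingQuot.ringQuot_ext' F g₁ g₂ (UniversalEnvelopingAlgebra.hom_ext F ?_)
  ext x
  exact h x

end

section

variable (p : ℕ) (F : Type*) [Field F] (L : Type*) [LieRing L] [LieAlgebra F L]
  [RestrictedLieAlgebra p F L]

/-- The universal property maps the algebra into the subalgebra generated by L; followed by the
inclusion this is the identity, by uniqueness. -/
theorem adjoin_range_ι : Algebra.adjoin F (Set.range (ι p F L)) = ⊤ := by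
  let S := Algebra.adjoin F (Set.range (ι p F L))
  let f : L →ₗ[F] S := (ι p F L).codRestrict (Subalgebra.toSubmodule S)
    fun x => Algebra.subset_adjoin ⟨x, rfl⟩
  obtain ⟨g, hg⟩ := exists_algHom (p := p) f (fun x y => Subtype.ext (ι_lie p F x y))
    fun x => Subtype.ext (ι_pow p F x)
  have : S.val.comp g = AlgHom.id F _ := hom_ext fun x => by
    rw [AlgHom.comp_apply, hg]
    rfl
  refine eq_top_iff.mpr fun a _ => ?_
  have ha : S.val (g a) = a := DFunLike.congr_fun this a
  rw [← ha]
  exact (g a).2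

theorem mul_comm_of_isLieAbelian [IsLieAbelian L] (a b : RestrictedEnvelopingAlgebra p F L) :
    a * b = b * a := by
  have hι : ∀ x y, ι p F L x * ι p F L y = ι p F L y * ι p F L x := fun x y => by
    have h := ι_lie p F x y
    rw [trivial_lie_zero, map_zero] at h
    exact sub_eq_zero.mp h.symm
  have h1 : ∀ x a, ι p F L x * a = a * ι p F L x := by
    intro x a
    have ha : a ∈ Algebra.adjoin F (Set.range (ι p F L)) := adjoin_range_ι p F L ▸ Algebra.mem_top
    have hle : Algebra.adjoin F (Set.range (ι p F L)) ≤
        Subalgebra.centralizer F (Set.range (ι p F L)) := by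
      refine Algebra.adjoin_le ?_
      rintro _ ⟨y, rfl⟩
      exact Subalgebra.mem_centralizer_iff F |>.mpr (by rintro _ ⟨z, rfl⟩; exact hι z y)
    exact (Subalgebra.mem_centralizer_iff F).mp (hle ha) _ ⟨x, rfl⟩
  have hb : b ∈ Algebra.adjoin F (Set.range (ι p F L)) := adjoin_range_ι p F L ▸ Algebra.mem_top
  have hle : Algebra.adjoin F (Set.range (ι p F L)) ≤ Subalgebra.center F _ := by
    refine Algebra.adjoin_le ?_
    rintro _ ⟨y, rfl⟩
    exact Subalgebra.mem_center_iff.mpr fun a => (h1 y a).symm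
  exact Subalgebra.mem_center_iff.mp (hle hb) a

end

end RestrictedEnvelopingAlgebra

namespace RestrictedLieAlgebra

variable (p : ℕ) [Fact p.Prime] (F : Type*) [Field F] [CharP F p] (L : Type*) [LieRing L]
  [LieAlgebra F L] [RestrictedLieAlgebra p F L] [IsLieAbelian L]

/-- The `p`-map of an abelian restricted Lie algebra is semilinear. -/
def pMapSemilinear : L →ₛₗ[frobenius F p] L where
  toFun := pMap p F
  map_add' x y := by
    rw [pMap_add, Finset.sum_eq_zero, add_zero]
    intro i _
    have had : ∀ z : L, (LieAlgebra.ad F L z : Module.End F L) = 0 := fun z => by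
      ext w
      exact trivial_lie_zero L L z w
    have hp := (Fact.out : p.Prime).two_le
    rw [jacobsonElement, had, had, map_zero, mul_zero, add_zero, zero_pow (by omega)]
    simp
  map_smul' a x := pMap_smul a x

end RestrictedLieAlgebra

namespace RestrictedEnvelopingAlgebra

variable {p : ℕ} [Fact p.Prime] {F : Type*} [Field F] [CharP F p] {L : Type*} [LieRing L]
  [LieAlgebra F L] [RestrictedLieAlgebra p F L] [IsLieAbelian L]

/-- The restricted enveloping algebra of an abelian restricted Lie algebra is the commutative
algebra with the relations `x ^ p = x^[p]`. -/
theorem exists_algEquiv_frobeniusAlgebra {σ : Type*} (b : Module.Basis σ F L) :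
    ∃ e : RestrictedEnvelopingAlgebra p F L ≃ₐ[F]
        FrobeniusAlgebra (RestrictedLieAlgebra.pMapSemilinear p F L) b,
      ∀ x, e (ι p F L x) = FrobeniusAlgebra.of _ b x := by
  let φ := RestrictedLieAlgebra.pMapSemilinear p F L
  obtain ⟨g, hg⟩ := exists_algHom (p := p) (FrobeniusAlgebra.of φ b)
    (fun x y => by rw [trivial_lie_zero, map_zero, mul_comm, sub_self]) (FrobeniusAlgebra.of_pow φ b)
  obtain ⟨g', hg'⟩ := FrobeniusAlgebra.exists_algHom φ b
    (mul_comm_of_isLieAbelian p F L) (ι p F L) (ι_pow p F)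
  refine ⟨AlgEquiv.ofAlgHom g g' ?_ ?_, hg⟩
  · refine AlgHom.ext_of_adjoin_eq_top (FrobeniusAlgebra.adjoin_range_of φ b) ?_
    rintro _ ⟨x, rfl⟩
    rw [AlgHom.comp_apply, hg']
    exact hg x
  · refine hom_ext fun x => ?_
    rw [AlgHom.comp_apply, hg]
    exact hg' x

/-- No finiteness is assumed, so this can be applied to H to deduce that H is finite-dimensional. -/
theorem ι_injective_of_isLieAbelian : Function.Injective (ι p F L) := by
  obtain ⟨e, he⟩ := exists_algEquiv_frobeniusAlgebra (p := p) (Module.Basis.ofVectorSpace F L)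
  intro x y h
  apply FrobeniusAlgebra.of_injective _ (Module.Basis.ofVectorSpace F L)
  rw [← he, h, he]

theorem finiteDimensional_of_isLieAbelian [PerfectRing F p] [FiniteDimensional F L] :
    FiniteDimensional F (RestrictedEnvelopingAlgebra p F L) := by
  obtain ⟨e, -⟩ := exists_algEquiv_frobeniusAlgebra (p := p) (Module.finBasis F L)
  have := FrobeniusAlgebra.finiteDimensional (RestrictedLieAlgebra.pMapSemilinear p F L)
    (Module.finBasis F L)
  exact Module.Finite.equiv e.symm.toLinearEquiv

/-- The invariant behind the theorem: the left side depends only on the associative algebra, the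
right side on the rank of the k-th iterate of the p-map. -/
theorem finrank_powSpan [PerfectRing F p] [FiniteDimensional F L] (k : ℕ) :
    Module.finrank F (powSpan F (RestrictedEnvelopingAlgebra p F L) (p ^ k)) =
      p ^ Module.finrank F (iteratedRange (RestrictedLieAlgebra.pMapSemilinear p F L) k) := by
  obtain ⟨σ, b, hb⟩ := exists_basis_finrank_powSpan (RestrictedLieAlgebra.pMapSemilinear p F L) k
  obtain ⟨e, -⟩ := exists_algEquiv_frobeniusAlgebra (p := p) b
  rw [← hb]
  exact finrank_powSpan_eq_of_algEquiv e _

end RestrictedEnvelopingAlgebra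

/-! ### Derivations through dual numbers -/

section Derivation

variable {p : ℕ} [Fact p.Prime] {F : Type*} [Field F] [CharP F p]
  {V : Type*} [AddCommGroup V] [Module F V] {S : Type*} [CommRing S] [Algebra F S]

/-- The dual-number lift `v ↦ j(v) + ε j(d(v))` of a linear map to an algebra. -/
def dualLift (j : V →ₗ[F] S) (d : V →ₗ[F] V) : V →ₗ[F] TrivSqZeroExt S S where
  toFun v := TrivSqZeroExt.inl (j v) + TrivSqZeroExt.inr (j (d v))
  map_add' v w := by ext <;> simp
  map_smul' a v := by ext <;> simp

/-- A p-th power kills the ε-part because ε² = 0 and p ≥ 2. The lifted relation therefore needs d to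
vanish on the image of φ, as a derivation annihilates p-th powers. -/
theorem dualLift_pow {j : V →ₗ[F] S} {φ : V →ₛₗ[frobenius F p] V} (hj : ∀ v, j v ^ p = j (φ v))
    {d : V →ₗ[F] V} (hd : ∀ v, d (φ v) = 0) (v : V) : dualLift j d v ^ p = dualLift j d (φ v) := by
  have hp := (Fact.out : p.Prime).two_le
  change (TrivSqZeroExt.inl (j v) + TrivSqZeroExt.inr (j (d v))) ^ p =
    TrivSqZeroExt.inl (j (φ v)) + TrivSqZeroExt.inr (j (d (φ v)))
  have hadd := add_pow_char_pow_of_algebra (p := p) F 1 (TrivSqZeroExt.inl (j v))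
    (TrivSqZeroExt.inr (j (d v)))
  rw [pow_one] at hadd
  rw [hadd, hd, map_zero,
    TrivSqZeroExt.inr_zero, add_zero, ← hj, TrivSqZeroExt.inl_pow, add_eq_left]
  obtain ⟨k, rfl⟩ := Nat.exists_eq_add_of_le hp
  rw [pow_add, pow_two, TrivSqZeroExt.inr_mul_inr, zero_mul]

/-- The derivation given by a section of the dual numbers. -/
theorem exists_derivation_of_algHom (g : S →ₐ[F] TrivSqZeroExt S S) (hg : ∀ a, (g a).fst = a) :
    ∃ D : Derivation F S S, ∀ a, D a = (g a).snd := by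
  let l : S →ₗ[F] S :=
    { toFun := fun a => (g a).snd
      map_add' := fun x y => by rw [map_add, TrivSqZeroExt.snd_add]
      map_smul' := fun a x => by rw [map_smul, TrivSqZeroExt.snd_smul, RingHom.id_apply] }
  refine ⟨Derivation.mk' l fun x y => ?_, fun a => rfl⟩
  change (g (x * y)).snd = x • (g y).snd + y • (g x).snd
  rw [map_mul, TrivSqZeroExt.snd_mul, hg, hg, op_smul_eq_smul]

end Derivation

/-! ### Multiplication operators twisted by derivations -/

section TwistedRepresentation

variable {p : ℕ} [Fact p.Prime] {F : Type*} [Field F] [CharP F p]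
  {V : Type*} [AddCommGroup V] [Module F V] {S : Type*} [CommRing S] [Algebra F S]
  {j : V →ₗ[F] S}

theorem derivation_ext_of_adjoin_range (hj : Algebra.adjoin F (Set.range j) = ⊤)
    {D₁ D₂ : Derivation F S S} (h : ∀ v, D₁ (j v) = D₂ (j v)) : D₁ = D₂ :=
  Derivation.ext_of_adjoin_eq_top _ hj (by rintro _ ⟨v, rfl⟩; exact h v)

/-- In characteristic `p`, a derivation whose square vanishes on generators has zero `p`-th
power. -/
theorem derivation_pow_char_eq_zero (hj : Algebra.adjoin F (Set.range j) = ⊤)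
    (D : Derivation F S S) (d : V → V) (hD : ∀ v, D (j v) = j (d v)) (hd : ∀ v, j (d (d v)) = 0) :
    ((D : S →ₗ[F] S) : Module.End F S) ^ p = 0 := by
  have hp := (Fact.out : p.Prime)
  set E : Module.End F S := (D : S →ₗ[F] S) with hE
  have hEa : ∀ s, E s = D s := fun _ => rfl
  -- Leibniz's formula has only two terms, as E² kills `j w`. At exponent p the second coefficient
  -- is zero, so E^p is S-linear, and it kills 1.
  have hstep : ∀ (k : ℕ) (w : V) (s : S), (E ^ (k + 1)) (j w * s) =
      j w * (E ^ (k + 1)) s + ((k + 1 : ℕ) : F) • (j (d w) * (E ^ k) s) := by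
    intro k w
    induction k with
    | zero => intro s; simp [hEa, hD, mul_comm, add_comm]
    | succ k ih =>
      intro s
      rw [pow_succ' E (k + 1), Module.End.mul_apply, ih, Module.End.mul_apply, map_add, map_smul,
        pow_succ' E k, Module.End.mul_apply]
      simp only [hEa, Derivation.leibniz, hD, hd, smul_eq_mul, mul_zero, add_zero]
      push_cast
      simp only [add_smul, one_smul]
      ring
  have hcomm : ∀ s t : S, (E ^ p) (s * t) = s * (E ^ p) t := by
    intro s
    have hs : s ∈ Algebra.adjoin F (Set.range j) := hj ▸ Algebra.mem_top
    induction hs using Algebra.adjoin_induction with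
    | mem x hx =>
      obtain ⟨w, rfl⟩ := hx
      intro t
      have h := hstep (p - 1) w t
      rwa [Nat.sub_add_cancel hp.one_le, CharP.cast_eq_zero, zero_smul, add_zero] at h
    | algebraMap r => intro t; rw [← Algebra.smul_def, map_smul, Algebra.smul_def]
    | add x y _ _ hx hy => intro t; rw [add_mul, map_add, hx, hy, add_mul]
    | mul x y _ _ hx hy => intro t; rw [mul_assoc, hx, hy, mul_assoc]
  ext1 s
  have h1 : (E ^ p) 1 = 0 := by
    rw [← Nat.sub_add_cancel hp.one_le, pow_succ, Module.End.mul_apply, hEa,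
      Derivation.map_one_eq_zero, map_zero]
  rw [← mul_one s, hcomm, h1, mul_zero, LinearMap.zero_apply]

/-- A bilinear map `β` deforms the multiplication operators of a commutative algebra generated by
`V` to operators with commutators `β(v, w) - β(w, v)`. -/
theorem exists_twisted_representation (hj : Algebra.adjoin F (Set.range j) = ⊤)
    {φ : V →ₛₗ[frobenius F p] V} (hjφ : ∀ v, j v ^ p = j (φ v)) (β : V →ₗ[F] V →ₗ[F] V)
    (hβ : ∀ u v w, β u (β v w) = 0) (D : V → Derivation F S S)
    (hD : ∀ v w, D v (j w) = j (β v w)) :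
    ∃ f : V →ₗ[F] Module.End F S,
      (∀ v w, f v * f w - f w * f v = LinearMap.mulLeft F (j (β v w - β w v))) ∧
      (∀ v, β v = 0 → f v = LinearMap.mulLeft F (j v)) ∧
      (∀ v, p = 2 ∨ β v v = 0 → f v ^ p = LinearMap.mulLeft F (j (φ v + β v v))) := by
  have hDadd : ∀ v w, D (v + w) = D v + D w := fun v w =>
    derivation_ext_of_adjoin_range hj fun u => by simp [hD]
  have hDsmul : ∀ (a : F) v, D (a • v) = a • D v := fun a v =>
    derivation_ext_of_adjoin_range hj fun u => by simp [hD]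
  have hDD : ∀ v w s, D v (D w s) = D w (D v s) := by
    intro v w s
    have : ⁅D v, D w⁆ = 0 := derivation_ext_of_adjoin_range hj fun u => by
      simp [Derivation.commutator_apply, hD, hβ]
    have h := DFunLike.congr_fun this s
    rw [Derivation.commutator_apply] at h
    exact sub_eq_zero.mp h
  have hpow : ∀ v, ((D v : S →ₗ[F] S) : Module.End F S) ^ p = 0 := fun v =>
    derivation_pow_char_eq_zero hj (D v) (β v) (hD v) fun w => by rw [hβ, map_zero]
  -- Multiplications commute with each other and so do the derivations; only D_v(j w) - D_w(j v)
  -- survives in a commutator.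
  let f : V →ₗ[F] Module.End F S :=
    { toFun := fun v => LinearMap.mulLeft F (j v) + (D v : S →ₗ[F] S)
      map_add' := fun v w => by
        ext1 s
        simp only [hDadd, LinearMap.add_apply, LinearMap.mulLeft_apply, map_add, add_mul,
          Derivation.coeFn_coe, Derivation.add_apply]
        abel
      map_smul' := fun a v => by
        ext1 s
        simp [hDsmul] }
  have hf : ∀ v s, f v s = j v * s + D v s := fun _ _ => rfl
  refine ⟨f, ?_, ?_, ?_⟩
  · intro v w
    ext1 s
    rw [LinearMap.sub_apply, Module.End.mul_apply, Module.End.mul_apply, LinearMap.mulLeft_apply]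
    simp only [hf, map_add, Derivation.leibniz, hD, smul_eq_mul, hDD v w, map_sub]
    ring
  · intro v hv
    have h0 : D v = 0 := derivation_ext_of_adjoin_range hj fun u => by simp [hD, hv]
    ext1 s
    rw [hf, h0, Derivation.zero_apply, add_zero, LinearMap.mulLeft_apply]
  · intro v hv
    by_cases hvv : β v v = 0
    · have hc : Commute (LinearMap.mulLeft F (j v) : Module.End F S) (D v : S →ₗ[F] S) := by
        ext1 s
        rw [Module.End.mul_apply, Module.End.mul_apply]
        simp [hD, hvv]
      have h1 : f v = LinearMap.mulLeft F (j v) + (D v : S →ₗ[F] S) := rfl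
      rw [h1, add_pow_char_of_commute_of_algebra F hc, hpow, hvv, add_zero, add_zero,
        LinearMap.pow_mulLeft, hjφ]
    -- For p = 2 the square of m + D, with m multiplication by `j v`, is m² + 2mD + D(j v) + D². The
    -- second and last terms vanish, and D(j v) supplies β(v, v).
    · have h2 : p = 2 := by tauto
      subst h2
      have hDD0 : ∀ s, D v (D v s) = 0 := fun s => by
        have := LinearMap.congr_fun (hpow v) s
        rwa [pow_two] at this
      ext1 s
      have h3 : ∀ x : S, x + x = 0 := fun x => by
        have : ((2 : ℕ) : F) • x = 0 := by rw [CharP.cast_eq_zero F 2, zero_smul]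
        rw [← this, Nat.cast_two, two_smul]
      rw [pow_two, Module.End.mul_apply, LinearMap.mulLeft_apply, map_add j, ← hjφ]
      simp only [hf, map_add, Derivation.leibniz, hD, smul_eq_mul, hDD0]
      linear_combination h3 (j v * D v s)

end TwistedRepresentation

namespace FrobeniusAlgebra

variable {p : ℕ} [Fact p.Prime] {F : Type*} [Field F] [CharP F p]
  {V : Type*} [AddCommGroup V] [Module F V] {ι : Type*}

theorem exists_derivation (φ : V →ₛₗ[frobenius F p] V) (b : Module.Basis ι F V) (d : V →ₗ[F] V)
    (hd : ∀ v, d (φ v) = 0) :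
    ∃ D : Derivation F (FrobeniusAlgebra φ b) (FrobeniusAlgebra φ b),
      ∀ v, D (of φ b v) = of φ b (d v) := by
  have hcomm : ∀ (S : Type _) [CommRing S] (x y : TrivSqZeroExt S S), x * y = y * x :=
    fun S _ x y => mul_comm x y
  obtain ⟨g, hg⟩ := exists_algHom φ b (hcomm _) (dualLift (of φ b) d)
    (dualLift_pow (of_pow φ b) hd)
  have hfst : (TrivSqZeroExt.fstHom F _ _).comp g = AlgHom.id F (FrobeniusAlgebra φ b) := by
    refine AlgHom.ext_of_adjoin_eq_top (adjoin_range_of φ b) ?_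
    rintro _ ⟨v, rfl⟩
    rw [AlgHom.comp_apply, hg]
    simp [dualLift]
  obtain ⟨D, hD⟩ := exists_derivation_of_algHom g fun a => DFunLike.congr_fun hfst a
  refine ⟨D, fun v => ?_⟩
  rw [hD, hg]
  simp [dualLift]

end FrobeniusAlgebra

/-! ### The bracket as an antisymmetrised bilinear map -/

section AlternatingDecomposition

variable {F : Type*} [Field F] {H : Type*} [LieRing H] [LieAlgebra F H]

/-- The bracket of a Lie algebra of class two is the antisymmetrisation of a bilinear map which
factors through the quotient by the centre and takes central values. -/
theorem exists_bilin_sub_eq_lie (hclass : ∀ x y z : H, ⁅⁅x, y⁆, z⁆ = 0) :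
    ∃ β : H →ₗ[F] H →ₗ[F] H, (∀ x y, β x y - β y x = ⁅x, y⁆) ∧
      (∀ x y z : H, ⁅β x y, z⁆ = 0) ∧
      (∀ z : H, (∀ w : H, ⁅z, w⁆ = 0) → ∀ x, β z x = 0 ∧ β x z = 0) := by
  classical
  let Z : Submodule F H :=
    { carrier := {z | ∀ w : H, ⁅z, w⁆ = 0}
      zero_mem' := fun w => zero_lie w
      add_mem' := fun {x y} hx hy w => by rw [add_lie, hx, hy, add_zero]
      smul_mem' := fun a x hx w => by rw [smul_lie, hx, smul_zero] }
  obtain ⟨s, hs⟩ := LinearMap.exists_rightInverse_of_surjective Z.mkQ (Z.range_mkQ)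
  have hs' : ∀ x, x - s (Z.mkQ x) ∈ Z := fun x =>
    (Submodule.Quotient.eq Z).mp (LinearMap.congr_fun hs (Z.mkQ x)).symm
  have hlie : ∀ x y, ⁅s (Z.mkQ x), s (Z.mkQ y)⁆ = ⁅x, y⁆ := fun x y => by
    have h1 : ∀ w, ⁅x, w⁆ = ⁅s (Z.mkQ x), w⁆ := fun w =>
      sub_eq_zero.mp ((sub_lie _ _ _).symm.trans (hs' x w))
    have h2 : ∀ w, ⁅w, y⁆ = ⁅w, s (Z.mkQ y)⁆ := fun w => by
      rw [← lie_skew, ← lie_skew w, neg_inj]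
      exact sub_eq_zero.mp ((sub_lie _ _ _).symm.trans (hs' y w))
    rw [h1, h2]
  let c := Module.Basis.ofVectorSpace F (H ⧸ Z)
  let _ : LinearOrder (Module.Basis.ofVectorSpaceIndex F (H ⧸ Z)) :=
    IsWellOrder.linearOrder WellOrderingRel
  -- Keeping the strictly upper triangular part of the bracket in an ordered basis avoids division
  -- by two, so it works in every characteristic.
  let βQ : (H ⧸ Z) →ₗ[F] (H ⧸ Z) →ₗ[F] Z := c.constr F fun i => c.constr F fun j =>
    if i < j then ⟨⁅s (c i), s (c j)⁆, hclass _ _⟩ else 0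
  have hβQ : ∀ i j, βQ (c i) (c j) = if i < j then ⟨⁅s (c i), s (c j)⁆, hclass _ _⟩ else 0 :=
    fun i j => by simp only [βQ, Module.Basis.constr_basis]
  have hsub : ∀ u v : H ⧸ Z, (βQ u v : H) - βQ v u = ⁅s u, s v⁆ := by
    intro u v
    let B₁ : (H ⧸ Z) →ₗ[F] (H ⧸ Z) →ₗ[F] H :=
      βQ.compr₂ Z.subtype - (βQ.compr₂ Z.subtype).flip
    let B₂ : (H ⧸ Z) →ₗ[F] (H ⧸ Z) →ₗ[F] H := LinearMap.mk₂ F (fun u v => ⁅s u, s v⁆)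
      (fun _ _ _ => by rw [map_add, add_lie]) (fun _ _ _ => by rw [map_smul, smul_lie])
      (fun _ _ _ => by rw [map_add, lie_add]) (fun _ _ _ => by rw [map_smul, lie_smul])
    have : B₁ = B₂ := by
      refine c.ext fun i => c.ext fun j => ?_
      change (βQ (c i) (c j) : H) - βQ (c j) (c i) = ⁅s (c i), s (c j)⁆
      rw [hβQ, hβQ]
      rcases lt_trichotomy i j with h | rfl | h
      · rw [if_pos h, if_neg h.not_gt, ZeroMemClass.coe_zero, sub_zero]
      · simp
      · rw [if_neg h.not_gt, if_pos h, ZeroMemClass.coe_zero, zero_sub, lie_skew]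
    exact LinearMap.congr_fun₂ this u v
  refine ⟨(βQ.compr₂ Z.subtype).compl₁₂ Z.mkQ Z.mkQ, ?_, ?_, ?_⟩
  · intro x y
    exact (hsub _ _).trans (hlie x y)
  · intro x y z
    exact (βQ (Z.mkQ x) (Z.mkQ y)).2 z
  · intro z hz x
    have : Z.mkQ z = 0 := (Submodule.Quotient.mk_eq_zero Z).mpr hz
    constructor <;> simp [this]

/-- As `exists_bilin_sub_eq_lie`, with an alternating map in characteristic other than two. -/
theorem exists_bilin_sub_eq_lie_of_char (p : ℕ) [Fact p.Prime] [CharP F p]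
    (hclass : ∀ x y z : H, ⁅⁅x, y⁆, z⁆ = 0) :
    ∃ β : H →ₗ[F] H →ₗ[F] H, (∀ x y, β x y - β y x = ⁅x, y⁆) ∧
      (∀ x y z : H, ⁅β x y, z⁆ = 0) ∧
      (∀ z : H, (∀ w : H, ⁅z, w⁆ = 0) → ∀ x, β z x = 0 ∧ β x z = 0) ∧
      (p = 2 ∨ ∀ x, β x x = 0) := by
  by_cases hp : p = 2
  · obtain ⟨β, h1, h2, h3⟩ := exists_bilin_sub_eq_lie (F := F) hclass
    exact ⟨β, h1, h2, h3, Or.inl hp⟩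
  · have h2 : (2 : F) ≠ 0 := Ring.two_ne_zero (by rwa [ringChar.eq F p])
    refine ⟨LinearMap.mk₂ F (fun x y => (2 : F)⁻¹ • ⁅x, y⁆)
      (fun _ _ _ => by rw [add_lie, smul_add]) (fun _ _ _ => by rw [smul_lie, smul_comm])
      (fun _ _ _ => by rw [lie_add, smul_add]) (fun _ _ _ => by rw [lie_smul, smul_comm]),
      fun x y => ?_, fun x y z => ?_, fun z hz x => ⟨?_, ?_⟩, Or.inr fun x => ?_⟩ <;>
      simp only [LinearMap.mk₂_apply]
    · rw [← lie_skew y x, smul_neg, sub_neg_eq_add, ← add_smul, ← two_mul, mul_inv_cancel₀ h2,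
        one_smul]
    · rw [smul_lie, hclass, smul_zero]
    · rw [hz, smul_zero]
    · rw [← lie_skew, hz, neg_zero, smul_zero]
    · rw [lie_self, smul_zero]

end AlternatingDecomposition

-- Applied to a = ad x, b = ad y in class two, this kills all Jacobson terms when p - 1 ≥ 2.
open Polynomial in
theorem sq_X_mul_C_add_C_eq_zero {R : Type*} [Ring R] {a b : R} (haa : a * a = 0)
    (hab : a * b = 0) (hba : b * a = 0) (hbb : b * b = 0) :
    (X * C a + C b : R[X]) ^ 2 = 0 := by
  have h : ∀ u v : R, u * v = 0 → (X * C u) * (X * C v) = (0 : R[X]) := fun u v huv => by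
    rw [mul_assoc, ← mul_assoc (C u), ← X_mul_C, mul_assoc X (C u), ← C_mul, huv, C_0, mul_zero,
      mul_zero]
  rw [pow_two, mul_add, add_mul, add_mul, h a a haa, X_mul_C, mul_assoc, X_mul_C, ← mul_assoc,
    ← C_mul, hba, ← mul_assoc, ← C_mul, hab, ← C_mul, hbb]
  simp

/-! ### Commutative u(H) forces H abelian -/

section ClassTwo

attribute [local instance] LieRing.ofAssociativeRing

variable {p : ℕ} [Fact p.Prime] {F : Type*} [Field F] {H : Type*} [LieRing H]
  [LieAlgebra F H] [RestrictedLieAlgebra p F H]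

open RestrictedLieAlgebra

theorem lie_pMap_of_class_two (hclass : ∀ x y z : H, ⁅⁅x, y⁆, z⁆ = 0) (x y : H) :
    ⁅pMap p F x, y⁆ = 0 := by
  have hp := (Fact.out : p.Prime).two_le
  have h := LinearMap.congr_fun (ad_pMap (p := p) (F := F) x) y
  rw [LieAlgebra.ad_apply] at h
  rw [h, show p = p - 2 + 2 by omega, pow_add, Module.End.mul_apply, pow_two,
    Module.End.mul_apply, LieAlgebra.ad_apply, LieAlgebra.ad_apply, ← lie_skew, hclass, neg_zero,
    map_zero]

variable [CharP F p]

theorem pMap_add_of_class_two (hclass : ∀ x y z : H, ⁅⁅x, y⁆, z⁆ = 0) (x y : H) :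
    pMap p F (x + y) = pMap p F x + pMap p F y + if p = 2 then ⁅x, y⁆ else 0 := by
  have hp := (Fact.out : p.Prime).two_le
  rw [pMap_add, add_right_inj]
  have hmul : ∀ u v : H, (LieAlgebra.ad F H u : Module.End F H) * LieAlgebra.ad F H v = 0 := by
    intro u v
    ext w
    change ⁅u, ⁅v, w⁆⁆ = 0
    rw [← lie_skew, hclass, neg_zero]
  split_ifs with h2
  · subst h2
    have : LieAlgebra.ad F H y x = ⁅x, y⁆ := by
      have h0 : (2 : F) = 0 := by exact_mod_cast CharP.cast_eq_zero F 2
      rw [LieAlgebra.ad_apply, ← lie_skew, neg_eq_iff_add_eq_zero, ← two_smul F, h0, zero_smul]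
    simp [jacobsonElement, this]
  · refine Finset.sum_eq_zero fun i _ => ?_
    have hsq := sq_X_mul_C_add_C_eq_zero (hmul x x) (hmul x y) (hmul y x) (hmul y y)
    rw [jacobsonElement, show p - 1 = 2 + (p - 3) by omega, pow_add, hsq, zero_mul]
    simp

/-- A restricted Lie algebra of class two with commutative restricted enveloping algebra is
abelian. -/
theorem lie_eq_zero_of_class_two (hclass : ∀ x y z : H, ⁅⁅x, y⁆, z⁆ = 0)
    (hcomm : ∀ a b : RestrictedEnvelopingAlgebra p F H, a * b = b * a) (x y : H) :
    ⁅x, y⁆ = 0 := by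
  obtain ⟨β, hβ, hβZ, hZβ, hβp⟩ := exists_bilin_sub_eq_lie_of_char (F := F) p hclass
  -- For p = 2 the p-map fails to be additive by [x, y] = β(x, y) + β(y, x), and subtracting the
  -- quadratic map β(x, x) repairs this. For odd p the correction is zero.
  let φ : H →ₛₗ[frobenius F p] H :=
    { toFun := fun x => pMap p F x - β x x
      map_add' := fun x y => by
        have h1 : (if p = 2 then ⁅x, y⁆ else 0) = β x y + β y x := by
          rcases eq_or_ne p 2 with h2 | h2
          · subst h2
            have h0 : (2 : F) = 0 := by exact_mod_cast CharP.cast_eq_zero F 2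
            rw [if_pos rfl, ← hβ, sub_eq_iff_eq_add, add_assoc, ← two_smul F, h0, zero_smul,
              add_zero]
          · have h3 := hβp.resolve_left h2
            have h4 := h3 (x + y)
            rw [if_neg h2]
            simp only [map_add, LinearMap.add_apply, h3, zero_add, add_zero] at h4
            rw [← h4]
            abel
        rw [pMap_add_of_class_two hclass, h1]
        simp only [map_add, LinearMap.add_apply]
        abel
      map_smul' := fun a x => by
        rw [pMap_smul, frobenius_def, smul_sub]
        congr 1
        rcases hβp with h2 | h2
        · rw [map_smul β, LinearMap.smul_apply, map_smul, smul_smul, h2, pow_two]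
        · rw [h2, h2, smul_zero] }
  have hφ : ∀ x, φ x = pMap p F x - β x x := fun _ => rfl
  have hφZ : ∀ x z : H, ⁅φ x, z⁆ = 0 := fun x z => by
    rw [hφ, sub_lie, lie_pMap_of_class_two hclass, hβZ, sub_zero]
  let b := Module.Basis.ofVectorSpace F H
  choose D hD using fun v => FrobeniusAlgebra.exists_derivation φ b (β v)
    fun w => (hZβ _ (hφZ w) v).2
  obtain ⟨f, hf1, hf2, hf3⟩ := exists_twisted_representation (FrobeniusAlgebra.adjoin_range_of φ b)
    (FrobeniusAlgebra.of_pow φ b) β (fun u v w => (hZβ _ (hβZ v w) u).2) D hD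
  have hfZ : ∀ z : H, (∀ w : H, ⁅z, w⁆ = 0) → f z = LinearMap.mulLeft F (FrobeniusAlgebra.of φ b z) :=
    fun z hz => hf2 z (LinearMap.ext fun w => (hZβ z hz w).1)
  obtain ⟨g, hg⟩ := RestrictedEnvelopingAlgebra.exists_algHom (p := p) f
    (fun x y => by rw [hf1, hβ, hfZ _ (hclass x y)])
    (fun x => by
      rw [hf3 x (hβp.imp_right fun h => h x), hfZ _ (lie_pMap_of_class_two hclass x), hφ,
        sub_add_cancel])
  -- The commutator acts as zero because u(H) is commutative, and as multiplication by its image in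
  -- S because it is central. Evaluating at 1 shows that this image is zero.
  have h0 : f ⁅x, y⁆ = 0 := by
    rw [← hg, RestrictedEnvelopingAlgebra.ι_lie, hcomm, sub_self, map_zero]
  rw [hfZ _ (hclass x y)] at h0
  have h1 := LinearMap.congr_fun h0 1
  rw [LinearMap.mulLeft_apply, mul_one, LinearMap.zero_apply] at h1
  exact (map_eq_zero_iff _ (FrobeniusAlgebra.of_injective φ b)).mp h1

/-- A restricted Lie algebra with commutative restricted enveloping algebra is abelian. -/
theorem isLieAbelian_of_mul_comm
    (hcomm : ∀ a b : RestrictedEnvelopingAlgebra p F H, a * b = b * a) : IsLieAbelian H := by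
  have had : ∀ u v : H, (LieAlgebra.ad F H ⁅u, v⁆ : Module.End F H) =
      LieAlgebra.ad F H u * LieAlgebra.ad F H v - LieAlgebra.ad F H v * LieAlgebra.ad F H u := by
    intro u v
    ext w
    exact lie_lie u v w
  -- The axiom ad(x^[p]) = (ad x)^p makes ad a representation of u(H); commutativity then gives ad
  -- [x, y] = 0.
  obtain ⟨g, hg⟩ := RestrictedEnvelopingAlgebra.exists_algHom (p := p)
    (LieAlgebra.ad F H).toLinearMap had (fun x => (ad_pMap x).symm)
  have hclass : ∀ x y z : H, ⁅⁅x, y⁆, z⁆ = 0 := by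
    intro x y z
    have h0 : (LieAlgebra.ad F H).toLinearMap ⁅x, y⁆ = 0 := by
      rw [← hg, RestrictedEnvelopingAlgebra.ι_lie, hcomm, sub_self, map_zero]
    exact LinearMap.congr_fun h0 z
  exact ⟨lie_eq_zero_of_class_two hclass hcomm⟩

end ClassTwo

theorem mainTheorem3 (p : ℕ) [Fact p.Prime]
    (F : Type*) [Field F] [IsAlgClosed F] [CharP F p]
    (L : Type*) [LieRing L] [LieAlgebra F L] [RestrictedLieAlgebra p F L]
    [FiniteDimensional F L] [IsLieAbelian L]
    (H : Type*) [LieRing H] [LieAlgebra F H] [RestrictedLieAlgebra p F H]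
    (h : Nonempty (RestrictedEnvelopingAlgebra p F L ≃ₐ[F] RestrictedEnvelopingAlgebra p F H)) :
    Nonempty (RestrictedLieEquiv p F L H) := by
  obtain ⟨e⟩ := h
  have : IsLieAbelian H := isLieAbelian_of_mul_comm (p := p) (F := F) fun a b => by
    apply e.symm.injective
    rw [map_mul, map_mul, RestrictedEnvelopingAlgebra.mul_comm_of_isLieAbelian]
  have : FiniteDimensional F (RestrictedEnvelopingAlgebra p F L) :=
    RestrictedEnvelopingAlgebra.finiteDimensional_of_isLieAbelian
  have : FiniteDimensional F (RestrictedEnvelopingAlgebra p F H) :=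
    Module.Finite.equiv e.toLinearEquiv
  have : FiniteDimensional F H := FiniteDimensional.of_injective
    (RestrictedEnvelopingAlgebra.ι p F H) RestrictedEnvelopingAlgebra.ι_injective_of_isLieAbelian
  obtain ⟨g, hg⟩ := exists_linearEquiv_of_finrank_iteratedRange_eq
    (RestrictedLieAlgebra.pMapSemilinear p F L) (RestrictedLieAlgebra.pMapSemilinear p F H)
    fun k => Nat.pow_right_injective (Fact.out : p.Prime).two_le (by
      simp only [← RestrictedEnvelopingAlgebra.finrank_powSpan]
      exact finrank_powSpan_eq_of_algEquiv e _)
  exact ⟨{ g with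
    map_lie' := fun {x y} => by
      rw [trivial_lie_zero, trivial_lie_zero]
      exact map_zero g
    map_pMap := hg }⟩
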